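/- Let $\Lambda$ be a finite set of sites and $\Lambda_B$ a set of bonds, i.e. of unordered pairs of sites of $\Lambda$; for each bond fix one ordering $(i,j)$ and a finite set of integers $m$. Let the group of spin values $\Phi$ be a compact subgroup of the group of angles $\mathbb{R}/2\pi\mathbb{Z}$, with a Haar measure $\mu$ (of any finite positive total mass), and let $d\mu(\phi)=\prod_{i\in\Lambda}d\mu(\phi_i)$ on $\Phi^\Lambda$. For $\beta_{ij,m}\ge 0$ (labels with $\beta_{ij,m}=0$ do not contribute), $\sigma_{ij,m}\ge 0$ and $D_{ij,m}\ge 0$, let $\omega_{ij,m}=J_{ij,m}-iK_{ij,m}$, where all $J_{ij,m},K_{ij,m}$ are independent real Gaussian variables of variance $\sigma_{ij,m}^2$ and means $D_{ij,m}$ and $0$ respectively, and set $$U=-\sum_{\langle ij\rangle\in\Lambda_B}\sum_m\beta_{ij,m}\,\Re\bigl[\omega_{ij,m}e^{im(\phi_i-\phi_j)}\bigr],\qquad Z=\int d\mu(\phi)\,e^{-U}.$$ On the Nishimori line, $D_{ij,m}=\beta_{ij,m}\sigma_{ij,m}^2$ for all $ij,m$, the variable $\log Z$ is integrable, and the quenched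 pressure $\mathbb{E}[\log Z]$ depends on $(\beta,\sigma,D)$ only through the parameters $x_{ij,m}=\beta_{ij,m}D_{ij,m}=\sigma_{ij,m}^2\beta_{ij,m}^2$. As a function of the vector $\{x_{ij,m}\}$, which ranges over all vectors with nonnegative coordinates, $\mathbb{E}[\log Z]$ is (jointly) convex. -/

import Mathlib

open MeasureTheory ProbabilityTheory
open scoped NNReal

namespace GaugeGlass

/-- The labels `(ij, m)` of the interactions: a bond `ij` together with one of the finitely many
integers `m` that occur on it. A bond, an unordered pair of sites, is represented by one of its
two orderings `(i, j)`, which fixes the sign in `φ i - φ j`. -/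
abbrev Coupling {Λ : Type*} (B : Finset (Λ × Λ)) (M : Λ × Λ → Finset ℤ) : Type _ :=
  (b : B) × M b.1

noncomputable section

variable {Λ : Type*} {B : Finset (Λ × Λ)} {M : Λ × Λ → Finset ℤ}

/-- The phase factor `exp (i m (φ_i - φ_j))` of the interaction `a = (ij, m)`; the spins take
values in a group `Φ` of angles, i.e. a subgroup of `ℝ / 2πℤ`. -/
def phase {Φ : AddSubgroup Real.Angle} (a : Coupling B M) (φ : Λ → Φ) : ℂ :=
  (((a.2 : ℤ) • ((φ a.1.1.1 : Real.Angle) - (φ a.1.1.2 : Real.Angle))).toCircle : ℂ)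

/-- The random potential `U = - ∑ β_{ij,m} Re (ω_{ij,m} exp (i m (φ_i - φ_j)))`.
Labels with `β_{ij,m} = 0` do not contribute. -/
def potential {Φ : AddSubgroup Real.Angle} (β : Coupling B M → ℝ) (ω : Coupling B M → ℂ)
    (φ : Λ → Φ) : ℝ :=
  -∑ a, β a * (ω a * phase a φ).re

/-- The partition function `Z = ∫ dμ(φ) exp (-U)`, for the product measure of copies of `μ`. -/
def partitionFunction [Fintype Λ] {Φ : AddSubgroup Real.Angle} [MeasurableSpace Φ] (μ : Measure Φ)
    (β : Coupling B M → ℝ) (ω : Coupling B M → ℂ) : ℝ :=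
  ∫ φ : Λ → Φ, Real.exp (-potential β ω φ) ∂(Measure.pi fun _ => μ)

/-- The complex Gaussian law of `ω = J - i K` with `J`, `K` independent real Gaussians of variance
`σ ^ 2` and means `D` and `0`. For `σ ≠ 0` its density is
`(2 π σ²)⁻¹ exp (-|ω - D|² / (2 σ²))`; for `σ = 0` it is the Dirac mass at `D`. -/
def complexGaussian (D : ℝ) (σ : ℝ≥0) : Measure ℂ :=
  ((gaussianReal D (σ ^ 2)).prod (gaussianReal 0 (σ ^ 2))).map
    fun p => (p.1 : ℂ) - Complex.I * (p.2 : ℂ)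

/-- The joint law `ν` of the independent disorder variables `ω_{ij,m}`. -/
def disorderLaw (D : Coupling B M → ℝ) (σ : Coupling B M → ℝ≥0) : Measure (Coupling B M → ℂ) :=
  Measure.pi fun a => complexGaussian (D a) (σ a)

/-- The quenched pressure `𝔼[log Z]`. -/
def quenchedPressure [Fintype Λ] {Φ : AddSubgroup Real.Angle} [MeasurableSpace Φ] (μ : Measure Φ)
    (β D : Coupling B M → ℝ) (σ : Coupling B M → ℝ≥0) : ℝ :=
  ∫ ω, Real.log (partitionFunction μ β ω) ∂(disorderLaw D σ)

/-- The Nishimori line `D_{ij,m} / σ_{ij,m}² = β_{ij,m}`, with the division cleared so that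
`σ_{ij,m} = 0` (and then `D_{ij,m} = 0`) is allowed. -/
def OnNishimoriLine (β D : Coupling B M → ℝ) (σ : Coupling B M → ℝ≥0) : Prop :=
  ∀ a, D a = β a * (σ a : ℝ) ^ 2

end

end GaugeGlass

/-!
On the Nishimori line the rescaled disorder `β ω` is the observation, in complex Gaussian noise with
components of variance `x`, of the signal `x` times the conjugate phase factors of a spin
configuration, here the zero configuration. Gauge invariance of `Z` (translation invariance of the
Haar measure together with rotation invariance of the noise) makes `𝔼[log Z]` the same for every
signal configuration, so the configuration may be averaged over the prior `∏ dμ`. The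
Cameron–Martin formula then turns the expectation into one under pure noise:
`𝔼[log Z] = ∑ x / 2 + |μ|⁻¹ E[W log W]`, where `W` is the integral over the prior of the likelihood
ratio `exp (∑ (√x_i g_i e_i - x_i e_i² / 2))`, the `e_i` are the real coordinates of the phase
factors and `g` is a standard Gaussian vector (`observationEntropy_eq`,
`integral_log_partitionFunction_eq`). This formula depends on `x` alone.

It remains to show that `E[W log W]` is jointly convex in `x`, for arbitrary bounded `e_i`. The
moments `∫ P w` of the likelihood ratio `w` solve the backward heat equation in `(x, √x g)`, so by
Gaussian integration by parts only second derivatives of a function of moments contribute to the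
`x`-derivative of its average (`hasDerivAt_integral_comp_moment`). Applied to `z log z` this gives
`∂_i E[W log W] = E[W ⟨e_i⟩²] / 2`, and applied to `a² / z` it gives
`∂_j ∂_i E[W log W] = E[W C_ij²] / 2`, where `⟨·⟩` is the posterior average and `C` the posterior
covariance matrix. By the Schur product theorem the Hadamard square of `C` is positive
semidefinite, hence so is the Hessian (`convexOn_observationEntropy_segment`). The boundary of the
orthant, where `√x` is not differentiable, is reached by continuity.
-/

namespace GaugeGlass

/-! ### Gaussian vectors -/

/-- The law of independent standard real Gaussians indexed by `ι`. -/
noncomputable abbrev gaussPi (ι : Type*) [Fintype ι] : Measure (ι → ℝ) :=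
  Measure.pi fun _ => gaussianReal 0 1

lemma integrable_exp_mul_abs_gaussianReal (κ : ℝ) :
    Integrable (fun z : ℝ => Real.exp (κ * |z|)) (gaussianReal 0 1) :=
  integrable_exp_mul_abs (X := fun z : ℝ => z) (integrable_exp_mul_gaussianReal κ)
    (integrable_exp_mul_gaussianReal (-κ))

lemma integrable_exp_mul_sum_abs {ι : Type*} [Fintype ι] (κ : ℝ) :
    Integrable (fun g : ι → ℝ => Real.exp (κ * ∑ i, |g i|)) (gaussPi ι) := by
  have h := Integrable.fintype_prod (μ := fun _ : ι => gaussianReal 0 1)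
    (f := fun _ z => Real.exp (κ * |z|)) fun _ => integrable_exp_mul_abs_gaussianReal κ
  refine h.congr (Filter.Eventually.of_forall fun g => ?_)
  simp [← Real.exp_sum, Finset.mul_sum]

/-- Resampling one coordinate preserves the product Gaussian measure. -/
lemma measurePreserving_update {ι : Type*} [Fintype ι] [DecidableEq ι] (i : ι) :
    MeasurePreserving (fun q : (ι → ℝ) × ℝ => Function.update q.1 i q.2)
      ((gaussPi ι).prod (gaussianReal 0 1)) (gaussPi ι) := by
  have hm : Measurable fun q : (ι → ℝ) × ℝ => Function.update q.1 i q.2 := by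
    refine measurable_pi_iff.2 fun j => ?_
    by_cases h : j = i
    · subst h; simpa using measurable_snd
    · simpa [h, Function.comp_def] using (measurable_pi_apply j).comp measurable_fst
  refine ⟨hm, (Measure.pi_eq fun s hs => ?_).symm⟩
  rw [Measure.map_apply hm (MeasurableSet.univ_pi hs)]
  have : (fun q : (ι → ℝ) × ℝ => Function.update q.1 i q.2) ⁻¹' Set.univ.pi s
      = (Set.univ.pi (Function.update s i Set.univ)) ×ˢ s i := by
    ext ⟨g, z⟩
    simp only [Set.mem_preimage, Set.mem_univ_pi, Set.mem_prod]
    constructor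
    · intro h
      refine ⟨fun j => ?_, by simpa using h i⟩
      by_cases hj : j = i
      · subst hj; simp
      · simpa [hj] using h j
    · rintro ⟨h, hz⟩ j
      by_cases hj : j = i
      · subst hj; simpa using hz
      · simpa [hj] using h j
  rw [this, Measure.prod_prod, Measure.pi_pi, ← Finset.mul_prod_erase _ _ (Finset.mem_univ i),
    ← Finset.mul_prod_erase Finset.univ (fun j => gaussianReal 0 1 (s j)) (Finset.mem_univ i)]
  simp only [Function.update_self, measure_univ, one_mul]
  rw [mul_comm]
  congr 1
  refine Finset.prod_congr rfl fun j hj => ?_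
  rw [Function.update_of_ne (Finset.ne_of_mem_erase hj)]

/-- Gaussian integration by parts in one variable. -/
lemma integral_mul_gaussianReal {f f' : ℝ → ℝ} (hf : ∀ z, HasDerivAt f (f' z) z)
    (h0 : Integrable f (gaussianReal 0 1)) (h1 : Integrable (fun z => z * f z) (gaussianReal 0 1))
    (h2 : Integrable f' (gaussianReal 0 1)) :
    ∫ z, z * f z ∂(gaussianReal 0 1) = ∫ z, f' z ∂(gaussianReal 0 1) := by
  have key : ∀ F : ℝ → ℝ, Integrable F (gaussianReal 0 1) →
      Integrable fun z => gaussianPDFReal 0 1 z * F z := by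
    intro F hF
    rw [gaussianReal_of_var_ne_zero _ one_ne_zero, integrable_withDensity_iff_integrable_smul'
      (measurable_gaussianPDF _ _) (Filter.Eventually.of_forall fun _ => gaussianPDF_lt_top)] at hF
    simpa only [toReal_gaussianPDF, smul_eq_mul] using hF
  have hρ : ∀ z, HasDerivAt (gaussianPDFReal 0 1) (-z * gaussianPDFReal 0 1 z) z := by
    intro z
    have h : HasDerivAt (fun z : ℝ => -(z - 0) ^ 2 / (2 * ((1 : ℝ≥0) : ℝ))) (-z) z := by
      have := (((hasDerivAt_id z).sub_const 0).pow 2).neg.div_const (2 * ((1 : ℝ≥0) : ℝ))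
      refine this.congr_deriv ?_
      simp [neg_div]
    have := (h.exp.const_mul (√(2 * Real.pi * ((1 : ℝ≥0) : ℝ)))⁻¹)
    rw [gaussianPDFReal_def]
    refine this.congr_deriv ?_
    ring
  have ibp := integral_mul_deriv_eq_deriv_mul_of_integrable (u := f) (v := gaussianPDFReal 0 1)
    (u' := f') (v' := fun z => -z * gaussianPDFReal 0 1 z) (fun z _ => hf z) (fun z _ => hρ z)
    (((key _ h1).neg).congr (Filter.Eventually.of_forall fun z => by
      simp only [Pi.mul_apply, Pi.neg_apply]; ring))
    ((key _ h2).congr (Filter.Eventually.of_forall fun z => by simp [mul_comm]))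
    ((key _ h0).congr (Filter.Eventually.of_forall fun z => by simp [mul_comm]))
  rw [integral_gaussianReal_eq_integral_smul one_ne_zero,
    integral_gaussianReal_eq_integral_smul one_ne_zero]
  simp only [smul_eq_mul]
  calc ∫ z, gaussianPDFReal 0 1 z * (z * f z)
      = -∫ z, f z * (-z * gaussianPDFReal 0 1 z) := by
        rw [← integral_neg]; congr 1; ext z; ring
    _ = ∫ z, gaussianPDFReal 0 1 z * f' z := by
        rw [ibp, neg_neg]; congr 1; ext z; ring

/-- Gaussian integration by parts in the coordinate `i` of a standard Gaussian vector. -/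
lemma integral_mul_gaussPi {ι : Type*} [Fintype ι] [DecidableEq ι] (i : ι) {A C : (ι → ℝ) → ℝ}
    (hA : ∀ g z, HasDerivAt (fun z => A (Function.update g i z)) (C (Function.update g i z)) z)
    (h0 : Integrable A (gaussPi ι)) (h1 : Integrable (fun g => g i * A g) (gaussPi ι))
    (h2 : Integrable C (gaussPi ι)) :
    ∫ g, g i * A g ∂(gaussPi ι) = ∫ g, C g ∂(gaussPi ι) := by
  have mp := measurePreserving_update i (ι := ι)
  have int : ∀ {F : (ι → ℝ) → ℝ}, Integrable F (gaussPi ι) →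
      Integrable (fun q : (ι → ℝ) × ℝ => F (Function.update q.1 i q.2))
        ((gaussPi ι).prod (gaussianReal 0 1)) :=
    fun hF => mp.integrable_comp_of_integrable hF
  have eq : ∀ {F : (ι → ℝ) → ℝ}, Integrable F (gaussPi ι) → ∫ g, F g ∂(gaussPi ι) =
      ∫ g, ∫ z, F (Function.update g i z) ∂(gaussianReal 0 1) ∂(gaussPi ι) := by
    intro F hF
    rw [← integral_prod (fun q : (ι → ℝ) × ℝ => F (Function.update q.1 i q.2)) (int hF),
      ← integral_map (f := F) mp.measurable.aemeasurable (by
        rw [mp.map_eq]; exact hF.aestronglyMeasurable), mp.map_eq]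
  rw [eq h1, eq h2]
  refine integral_congr_ae ?_
  filter_upwards [(int h0).prod_right_ae, (int h1).prod_right_ae, (int h2).prod_right_ae]
    with g e0 e1 e2
  simp only [Function.update_self] at e1 ⊢
  exact integral_mul_gaussianReal (hA g) e0 e1 e2

lemma gaussianReal_eq_withDensity (v : ℝ) : gaussianReal v 1 =
    (gaussianReal 0 1).withDensity fun z => ENNReal.ofReal (Real.exp (v * z - v ^ 2 / 2)) := by
  rw [gaussianReal_of_var_ne_zero _ one_ne_zero, gaussianReal_of_var_ne_zero _ one_ne_zero,
    ← withDensity_mul _ (measurable_gaussianPDF _ _) (by fun_prop)]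
  congr 1
  ext z
  rw [Pi.mul_apply, gaussianPDF, gaussianPDF, ← ENNReal.ofReal_mul (gaussianPDFReal_nonneg _ _ _),
    gaussianPDFReal, gaussianPDFReal, mul_assoc _ (Real.exp _), ← Real.exp_add]
  congr 3
  simp only [NNReal.coe_one]
  ring

/-- The Cameron–Martin formula for a standard Gaussian vector. -/
lemma integral_add_gaussPi {ι : Type*} [Fintype ι] (v : ι → ℝ) (F : (ι → ℝ) → ℝ) :
    ∫ g, F (g + v) ∂(gaussPi ι) =
      ∫ g, Real.exp (∑ i, (v i * g i - v i ^ 2 / 2)) * F g ∂(gaussPi ι) := by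
  have h1 : (gaussPi ι).map (fun g => g + v) = Measure.pi fun i => gaussianReal (v i) 1 := by
    have := Measure.pi_map_pi (μ := fun _ : ι => gaussianReal 0 1) (f := fun i z => z + v i)
      (fun i => by fun_prop)
    simp only [gaussianReal_map_add_const, zero_add] at this
    exact this
  have hm : Measurable fun g : ι → ℝ =>
      Real.toNNReal (Real.exp (∑ i, (v i * g i - v i ^ 2 / 2))) := by fun_prop
  have h2 : (Measure.pi fun i => gaussianReal (v i) 1) = (gaussPi ι).withDensity
      fun g => (Real.toNNReal (Real.exp (∑ i, (v i * g i - v i ^ 2 / 2))) : ENNReal) := by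
    refine Measure.pi_eq fun s hs => ?_
    rw [withDensity_apply _ (MeasurableSet.univ_pi hs), gaussPi, Measure.restrict_pi_pi]
    have hint : ∀ i, Integrable (fun z => Real.exp (v i * z - v i ^ 2 / 2))
        ((gaussianReal 0 1).restrict (s i)) := fun i => by
      simp_rw [Real.exp_sub]
      exact ((integrable_exp_mul_gaussianReal (v i)).div_const _).restrict
    have hprod := Integrable.fintype_prod hint
    simp_rw [← Real.exp_sum] at hprod
    change ∫⁻ g : ι → ℝ, ENNReal.ofReal (Real.exp (∑ i, (v i * g i - v i ^ 2 / 2))) ∂_ = _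
    rw [← ofReal_integral_eq_lintegral_ofReal hprod
      (Filter.Eventually.of_forall fun _ => (Real.exp_pos _).le)]
    simp_rw [Real.exp_sum]
    rw [integral_fintype_prod_eq_prod (fun i z => Real.exp (v i * z - v i ^ 2 / 2)),
      ENNReal.ofReal_prod_of_nonneg fun i _ => integral_nonneg fun _ => (Real.exp_pos _).le]
    refine Finset.prod_congr rfl fun i _ => ?_
    rw [gaussianReal_eq_withDensity (v i), withDensity_apply _ (hs i),
      ofReal_integral_eq_lintegral_ofReal (hint i)
        (Filter.Eventually.of_forall fun _ => (Real.exp_pos _).le)]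
  have h3 := integral_map_equiv (μ := gaussPi ι) (MeasurableEquiv.addRight v) F
  rw [MeasurableEquiv.coe_addRight, h1, h2, integral_withDensity_eq_integral_smul hm] at h3
  rw [← h3]
  congr 1
  ext g
  rw [NNReal.smul_def, Real.coe_toNNReal _ (Real.exp_pos _).le, smul_eq_mul]

/-! ### The heat equation for Gaussian averages -/

/-- A function of a standard Gaussian vector that is dominated by `K exp (κ ∑ |g_i|)` is
integrable. -/
lemma integrable_gaussPi_of_le {ι : Type*} [Fintype ι] {F : (ι → ℝ) → ℝ} (hF : Measurable F)
    {K κ : ℝ} (hb : ∀ g, |F g| ≤ K * Real.exp (κ * ∑ i, |g i|)) : Integrable F (gaussPi ι) :=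
  ((integrable_exp_mul_sum_abs κ).const_mul K).mono' hF.aestronglyMeasurable
    (Filter.Eventually.of_forall hb)

lemma abs_coord_mul_le {ι : Type*} [Fintype ι] {κ K a : ℝ} {g : ι → ℝ} (i : ι)
    (ha : |a| ≤ K * Real.exp (κ * ∑ j, |g j|)) :
    |g i * a| ≤ K * Real.exp ((κ + 1) * ∑ j, |g j|) := by
  have h1 : |g i| ≤ Real.exp (∑ j, |g j|) :=
    (Finset.single_le_sum (f := fun j => |g j|) (fun j _ => abs_nonneg _) (Finset.mem_univ i)).trans
      ((lt_add_one _).le.trans (Real.add_one_le_exp _))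
  rw [abs_mul, add_mul, one_mul, Real.exp_add]
  calc |g i| * |a| ≤ Real.exp (∑ j, |g j|) * (K * Real.exp (κ * ∑ j, |g j|)) := by gcongr
    _ = _ := by ring

/-- The heat equation behind the Itô formula. When `Ψ t g` depends on `t` and `g` through `s_i g_i`
and `s_i ^ 2`, its time derivative contains the noise `g_i` linearly, and integration by parts
removes that noise. -/
lemma hasDerivAt_integral_gaussPi {ι : Type*} [Fintype ι] [DecidableEq ι]
    {Ψ : ℝ → (ι → ℝ) → ℝ} {A B : ι → ℝ → (ι → ℝ) → ℝ} {C : ι → (ι → ℝ) → ℝ} {s s' : ℝ → ι → ℝ}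
    {t₀ ε K κ R : ℝ} (hε : 0 < ε)
    (mΨ : ∀ t, Measurable (Ψ t)) (mA : ∀ i t, Measurable (A i t))
    (mB : ∀ i t, Measurable (B i t)) (mC : ∀ i, Measurable (C i))
    (bΨ : ∀ g, |Ψ t₀ g| ≤ K * Real.exp (κ * ∑ i, |g i|))
    (bA : ∀ i, ∀ t ∈ Metric.ball t₀ ε, ∀ g, |A i t g| ≤ K * Real.exp (κ * ∑ i, |g i|))
    (bB : ∀ i, ∀ t ∈ Metric.ball t₀ ε, ∀ g, |B i t g| ≤ K * Real.exp (κ * ∑ i, |g i|))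
    (bC : ∀ i g, |C i g| ≤ K * Real.exp (κ * ∑ i, |g i|))
    (bs : ∀ t ∈ Metric.ball t₀ ε, ∀ i, |s t i| ≤ R)
    (bs' : ∀ t ∈ Metric.ball t₀ ε, ∀ i, |s' t i| ≤ R)
    (hΨ : ∀ g, ∀ t ∈ Metric.ball t₀ ε,
      HasDerivAt (fun t => Ψ t g) (∑ i, s' t i * (g i * A i t g - s t i * B i t g)) t)
    (hA : ∀ i g z, HasDerivAt (fun z => A i t₀ (Function.update g i z))
      (s t₀ i * C i (Function.update g i z)) z) :
    HasDerivAt (fun t => ∫ g, Ψ t g ∂(gaussPi ι))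
      (∑ i, s' t₀ i * s t₀ i * ∫ g, (C i g - B i t₀ g) ∂(gaussPi ι)) t₀ := by
  have ht₀ : t₀ ∈ Metric.ball t₀ ε := Metric.mem_ball_self hε
  have iA : ∀ i, Integrable (A i t₀) (gaussPi ι) :=
    fun i => integrable_gaussPi_of_le (mA i t₀) (bA i t₀ ht₀)
  have iB : ∀ i, Integrable (B i t₀) (gaussPi ι) :=
    fun i => integrable_gaussPi_of_le (mB i t₀) (bB i t₀ ht₀)
  have iC : ∀ i, Integrable (C i) (gaussPi ι) :=
    fun i => integrable_gaussPi_of_le (mC i) (bC i)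
  have igA : ∀ i, Integrable (fun g => g i * A i t₀ g) (gaussPi ι) :=
    fun i => integrable_gaussPi_of_le ((measurable_pi_apply i).mul (mA i t₀))
      fun g => abs_coord_mul_le i (bA i t₀ ht₀ g)
  have main := (hasDerivAt_integral_of_dominated_loc_of_deriv_le (μ := gaussPi ι) (F := Ψ)
    (F' := fun t g => ∑ i, s' t i * (g i * A i t g - s t i * B i t g)) (x₀ := t₀)
    (bound := fun g => ∑ _i : ι, |R| * (K * Real.exp ((κ + 1) * ∑ i, |g i|)
      + |R| * (K * Real.exp (κ * ∑ i, |g i|))))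
    (Metric.ball_mem_nhds t₀ hε)
    (Filter.Eventually.of_forall fun t => (mΨ t).aestronglyMeasurable)
    (integrable_gaussPi_of_le (mΨ t₀) bΨ)
    (Measurable.aestronglyMeasurable (by fun_prop))
    (Filter.Eventually.of_forall fun g t ht => ?_)
    (integrable_finsetSum _ fun i _ => (((integrable_exp_mul_sum_abs _).const_mul K).add
      (((integrable_exp_mul_sum_abs _).const_mul K).const_mul _)).const_mul _)
    (Filter.Eventually.of_forall fun g t ht => hΨ g t ht)).2
  · refine main.congr_deriv ?_
    have iAB : ∀ i, Integrable (fun g => s' t₀ i * (g i * A i t₀ g - s t₀ i * B i t₀ g))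
        (gaussPi ι) := fun i => ((igA i).sub ((iB i).const_mul (s t₀ i))).const_mul (s' t₀ i)
    rw [integral_finsetSum _ fun i _ => iAB i]
    refine Finset.sum_congr rfl fun i _ => ?_
    rw [integral_const_mul, integral_sub (igA i) ((iB i).const_mul _),
      integral_mul_gaussPi i (hA i) (iA i) (igA i) ((iC i).const_mul _), integral_const_mul,
      integral_const_mul, integral_sub (iC i) (iB i)]
    ring
  · refine (Finset.abs_sum_le_sum_abs _ _).trans (Finset.sum_le_sum fun i _ => ?_)
    have h1 := (bs t ht i).trans (le_abs_self R)
    have h2 := (bs' t ht i).trans (le_abs_self R)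
    have h3 := abs_coord_mul_le i (bA i t ht g)
    have h4 := bB i t ht g
    rw [abs_mul]
    refine mul_le_mul h2 ((abs_sub _ _).trans (add_le_add h3 ?_)) (abs_nonneg _) (abs_nonneg _)
    rw [abs_mul]
    exact mul_le_mul h1 h4 (abs_nonneg _) (abs_nonneg _)

/-! ### Moments of the Gaussian likelihood ratio -/

lemma abs_sum_mul_le {κ : Type*} [Fintype κ] {f y R : κ → ℝ} (hf : ∀ k, |f k| ≤ 1)
    (hy : ∀ k, |y k| ≤ R k) : |∑ k, y k * f k| ≤ ∑ k, R k := by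
  refine (Finset.abs_sum_le_sum_abs _ _).trans (Finset.sum_le_sum fun k _ => ?_)
  rw [abs_mul]
  calc |y k| * |f k| ≤ R k * 1 :=
        mul_le_mul (hy k) (hf k) (abs_nonneg _) ((abs_nonneg _).trans (hy k))
    _ = R k := mul_one _

section Weight

variable {Ω ι : Type*} [Fintype ι]

/-- The likelihood ratio `exp (∑ (s_i g_i e_i - s_i² e_i² / 2))` of the observation `s_i g_i` of the
signal `s_i² e_i` in Gaussian noise of variance `s_i²`, against pure noise. -/
noncomputable def weight (e : ι → Ω → ℝ) (s g : ι → ℝ) (ω : Ω) : ℝ :=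
  Real.exp (∑ i, (s i * g i * e i ω - s i ^ 2 * e i ω ^ 2 / 2))

variable {e : ι → Ω → ℝ}

lemma weight_eq (s g : ι → ℝ) (ω : Ω) : weight e s g ω =
    Real.exp (∑ k, Sum.elim (fun i => s i * g i) (fun i => -(s i ^ 2 / 2)) k *
      Sum.elim (fun i => e i ω) (fun i => e i ω ^ 2) k) := by
  rw [weight, Fintype.sum_sum_type, ← Finset.sum_add_distrib]
  congr 1
  refine Finset.sum_congr rfl fun i _ => ?_
  simp only [Sum.elim_inl, Sum.elim_inr]
  ring

lemma weight_le (he : ∀ i ω, |e i ω| ≤ 1) {s g : ι → ℝ} {R : ℝ} (hs : ∀ i, |s i| ≤ R) (ω : Ω) :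
    weight e s g ω ≤ Real.exp (R * ∑ i, |g i|) := by
  refine Real.exp_le_exp.2 ?_
  rw [Finset.mul_sum]
  refine Finset.sum_le_sum fun i _ => ?_
  have h1 : s i * g i * e i ω ≤ R * |g i| := by
    refine (le_abs_self _).trans ?_
    rw [abs_mul, abs_mul]
    calc |s i| * |g i| * |e i ω| ≤ R * |g i| * 1 := by
          have := (abs_nonneg _).trans (hs i)
          gcongr
          · exact hs i
          · exact he i ω
      _ = _ := mul_one _
  nlinarith [mul_nonneg (sq_nonneg (s i)) (sq_nonneg (e i ω))]

lemma le_weight (he : ∀ i ω, |e i ω| ≤ 1) {s g : ι → ℝ} {R : ℝ} (hs : ∀ i, |s i| ≤ R) (ω : Ω) :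
    Real.exp (-(Fintype.card ι * (R ^ 2 / 2) + R * ∑ i, |g i|)) ≤ weight e s g ω := by
  refine Real.exp_le_exp.2 ?_
  have hc : (Fintype.card ι * (R ^ 2 / 2) : ℝ) = ∑ _i : ι, R ^ 2 / 2 := by
    simp
  rw [hc, Finset.mul_sum, ← Finset.sum_add_distrib, ← Finset.sum_neg_distrib]
  refine Finset.sum_le_sum fun i _ => ?_
  have h1 : -(R * |g i|) ≤ s i * g i * e i ω := by
    refine neg_le_of_abs_le ?_
    rw [abs_mul, abs_mul]
    calc |s i| * |g i| * |e i ω| ≤ R * |g i| * 1 := by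
          have := (abs_nonneg _).trans (hs i)
          gcongr
          · exact hs i
          · exact he i ω
      _ = _ := mul_one _
  have h2 : s i ^ 2 ≤ R ^ 2 := sq_le_sq' (neg_le_of_abs_le (hs i)) (le_of_abs_le (hs i))
  have h3 : e i ω ^ 2 ≤ 1 := by
    simpa [sq_abs] using pow_le_one₀ (n := 2) (abs_nonneg _) (he i ω)
  nlinarith [mul_le_mul h2 h3 (sq_nonneg _) (sq_nonneg _)]

end Weight

section Moments

variable {Ω ι : Type*} [MeasurableSpace Ω] [Fintype ι]

/-- Derivative of an exponential integral along a curve of its parameters. -/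
lemma hasDerivAt_integral_exp {κ : Type*} [Fintype κ] (m : Measure Ω) [IsFiniteMeasure m]
    {f : κ → Ω → ℝ} (mf : ∀ k, Measurable (f k)) (hf : ∀ k ω, |f k ω| ≤ 1)
    {P : Ω → ℝ} (mP : Measurable P) (hP : ∀ ω, |P ω| ≤ 1) {y : ℝ → κ → ℝ} {y' : κ → ℝ} {t : ℝ}
    (hy : ∀ k, HasDerivAt (fun t => y t k) (y' k) t) :
    HasDerivAt (fun t => ∫ ω, P ω * Real.exp (∑ k, y t k * f k ω) ∂m)
      (∑ k, y' k * ∫ ω, P ω * f k ω * Real.exp (∑ k, y t k * f k ω) ∂m) t := by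
  let pr : κ → ((κ → ℝ) →L[ℝ] ℝ) := fun k => ContinuousLinearMap.proj k
  have bE : ∀ ω, ∀ z ∈ Metric.ball (y t) 1,
      Real.exp (∑ k, z k * f k ω) ≤ Real.exp (∑ k, (|y t k| + 1)) := by
    intro ω z hz
    refine Real.exp_le_exp.2 ((le_abs_self _).trans (abs_sum_mul_le (fun k => hf k ω) fun k => ?_))
    have h1 : |z k - y t k| ≤ 1 := by
      rw [Metric.mem_ball, dist_eq_norm] at hz
      exact (norm_le_pi_norm (z - y t) k).trans hz.le
    have h2 : |z k| ≤ |z k - y t k| + |y t k| := by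
      simpa using abs_add_le (z k - y t k) (y t k)
    linarith
  have mF : ∀ z : κ → ℝ, Measurable fun ω => P ω * Real.exp (∑ k, z k * f k ω) := fun z => by
    fun_prop
  have mF' : ∀ z : κ → ℝ, AEStronglyMeasurable (fun ω =>
      ∑ k, (P ω * (Real.exp (∑ k, z k * f k ω) * f k ω)) • pr k) m := fun z => by
    refine Finset.aestronglyMeasurable_fun_sum _ fun k _ => ?_
    refine AEStronglyMeasurable.smul_const (Measurable.aestronglyMeasurable ?_) _
    fun_prop
  have bF' : ∀ ω, ∀ z ∈ Metric.ball (y t) 1,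
      ‖∑ k, (P ω * (Real.exp (∑ k, z k * f k ω) * f k ω)) • pr k‖
        ≤ ∑ k, Real.exp (∑ k, (|y t k| + 1)) * ‖pr k‖ := by
    intro ω z hz
    refine (norm_sum_le _ _).trans (Finset.sum_le_sum fun k _ => ?_)
    rw [norm_smul]
    refine mul_le_mul_of_nonneg_right ?_ (norm_nonneg _)
    rw [Real.norm_eq_abs, abs_mul, abs_mul, Real.abs_exp]
    calc |P ω| * (Real.exp (∑ k, z k * f k ω) * |f k ω|)
        ≤ 1 * (Real.exp (∑ k, (|y t k| + 1)) * 1) := by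
          gcongr ?_ * (?_ * ?_)
          · exact hP ω
          · exact bE ω z hz
          · exact hf k ω
      _ = _ := by ring
  have ht : y t ∈ Metric.ball (y t) 1 := Metric.mem_ball_self one_pos
  have iF' : Integrable (fun ω =>
      ∑ k, (P ω * (Real.exp (∑ k, y t k * f k ω) * f k ω)) • pr k) m :=
    Integrable.of_bound (mF' _) _ (Filter.Eventually.of_forall fun ω => bF' ω _ ht)
  have main := hasFDerivAt_integral_of_dominated_of_fderiv_le (μ := m)
    (F := fun (z : κ → ℝ) ω => P ω * Real.exp (∑ k, z k * f k ω))
    (F' := fun z ω => ∑ k, (P ω * (Real.exp (∑ k, z k * f k ω) * f k ω)) • pr k)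
    (Metric.ball_mem_nhds (y t) one_pos)
    (Filter.Eventually.of_forall fun z => (mF z).aestronglyMeasurable)
    (Integrable.of_bound (mF _).aestronglyMeasurable (Real.exp (∑ k, (|y t k| + 1)))
      (Filter.Eventually.of_forall fun ω => by
        rw [Real.norm_eq_abs, abs_mul, Real.abs_exp]
        calc |P ω| * Real.exp (∑ k, y t k * f k ω) ≤ 1 * Real.exp (∑ k, (|y t k| + 1)) := by
              gcongr ?_ * ?_
              · exact hP ω
              · exact bE ω _ ht
          _ = _ := one_mul _))
    (mF' _) (Filter.Eventually.of_forall bF') (integrable_const _)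
    (Filter.Eventually.of_forall fun ω z _ => by
      have h1 : HasFDerivAt (fun z : κ → ℝ => ∑ k, z k * f k ω) (∑ k, f k ω • pr k) z :=
        HasFDerivAt.fun_sum fun k _ => (pr k).hasFDerivAt.mul_const (f k ω)
      refine (h1.exp.const_mul (P ω)).congr_fderiv ?_
      simp only [Finset.smul_sum, smul_smul])
  have hcomp := main.comp_hasDerivAt t (hasDerivAt_pi.2 hy)
  refine hcomp.congr_deriv ?_
  rw [ContinuousLinearMap.integral_apply iF']
  simp only [sum_apply, smul_apply, smul_eq_mul, pr,
    ContinuousLinearMap.proj_apply]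
  rw [integral_finsetSum]
  · refine Finset.sum_congr rfl fun k _ => ?_
    rw [← integral_const_mul]
    congr 1
    ext ω
    ring
  · intro k _
    refine Integrable.of_bound (Measurable.aestronglyMeasurable (by fun_prop))
      (Real.exp (∑ k, (|y t k| + 1)) * |y' k|) (Filter.Eventually.of_forall fun ω => ?_)
    rw [Real.norm_eq_abs, abs_mul, abs_mul, abs_mul, Real.abs_exp]
    refine mul_le_mul_of_nonneg_right ?_ (abs_nonneg _)
    calc |P ω| * (Real.exp (∑ k, y t k * f k ω) * |f k ω|)
        ≤ 1 * (Real.exp (∑ k, (|y t k| + 1)) * 1) := by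
          gcongr ?_ * (?_ * ?_)
          · exact hP ω
          · exact bE ω _ ht
          · exact hf k ω
      _ = _ := by ring

/-- The integral of `P` against the measure `m` weighted by the likelihood ratio. -/
noncomputable def moment (m : Measure Ω) (e : ι → Ω → ℝ) (P : Ω → ℝ) (s g : ι → ℝ) : ℝ :=
  ∫ ω, P ω * weight e s g ω ∂m

variable {m : Measure Ω} [IsFiniteMeasure m] {e : ι → Ω → ℝ}

lemma hasDerivAt_moment (me : ∀ i, Measurable (e i)) (he : ∀ i ω, |e i ω| ≤ 1)
    {P : Ω → ℝ} (mP : Measurable P) (hP : ∀ ω, |P ω| ≤ 1) {s g : ℝ → ι → ℝ} {s' g' : ι → ℝ} {t : ℝ}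
    (hs : ∀ i, HasDerivAt (fun t => s t i) (s' i) t)
    (hg : ∀ i, HasDerivAt (fun t => g t i) (g' i) t) :
    HasDerivAt (fun t => moment m e P (s t) (g t))
      (∑ i, ((s' i * g t i + s t i * g' i) * moment m e (fun ω => P ω * e i ω) (s t) (g t)
        - s' i * s t i * moment m e (fun ω => P ω * e i ω ^ 2) (s t) (g t))) t := by
  have h := hasDerivAt_integral_exp m
    (f := fun k ω => Sum.elim (fun i => e i ω) (fun i => e i ω ^ 2) k)
    (by rintro (i | i)
        · exact me i
        · exact (me i).pow_const 2)
    (by rintro (i | i) ω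
        · exact he i ω
        · simpa [abs_pow] using he i ω) mP hP
    (y := fun t => Sum.elim (fun i => s t i * g t i) (fun i => -(s t i ^ 2 / 2)))
    (y' := Sum.elim (fun i => s' i * g t i + s t i * g' i) (fun i => -(s' i * s t i))) (t := t)
    (by rintro (i | i)
        · exact (hs i).mul (hg i)
        · refine (((hs i).pow 2).div_const 2).neg.congr_deriv ?_
          simp
          ring)
  simp only [moment, weight_eq]
  refine h.congr_deriv ?_
  rw [Fintype.sum_sum_type, ← Finset.sum_add_distrib]
  refine Finset.sum_congr rfl fun i _ => ?_
  simp only [Sum.elim_inl, Sum.elim_inr]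
  ring

lemma hasDerivAt_moment_time (me : ∀ i, Measurable (e i)) (he : ∀ i ω, |e i ω| ≤ 1)
    {P : Ω → ℝ} (mP : Measurable P) (hP : ∀ ω, |P ω| ≤ 1) {s : ℝ → ι → ℝ} {s' : ι → ℝ} {t : ℝ}
    (hs : ∀ i, HasDerivAt (fun t => s t i) (s' i) t) (g : ι → ℝ) :
    HasDerivAt (fun t => moment m e P (s t) g)
      (∑ i, s' i * (g i * moment m e (fun ω => P ω * e i ω) (s t) g
        - s t i * moment m e (fun ω => P ω * e i ω ^ 2) (s t) g)) t := by
  refine (hasDerivAt_moment me he mP hP hs (g := fun _ => g) (g' := 0)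
    fun i => hasDerivAt_const t (g i)).congr_deriv (Finset.sum_congr rfl fun i _ => ?_)
  simp only [Pi.zero_apply]
  ring

lemma hasDerivAt_moment_update [DecidableEq ι] (me : ∀ i, Measurable (e i))
    (he : ∀ i ω, |e i ω| ≤ 1) {P : Ω → ℝ} (mP : Measurable P) (hP : ∀ ω, |P ω| ≤ 1) (s g : ι → ℝ)
    (i : ι) (z : ℝ) :
    HasDerivAt (fun z => moment m e P s (Function.update g i z))
      (s i * moment m e (fun ω => P ω * e i ω) s (Function.update g i z)) z := by
  refine (hasDerivAt_moment me he mP hP (s := fun _ => s) (s' := 0)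
    (fun j => hasDerivAt_const z (s j)) (g := fun z => Function.update g i z)
    (hasDerivAt_pi.1 (hasDerivAt_update g i z))).congr_deriv ?_
  rw [Finset.sum_eq_single i]
  · simp
  · intro j _ hj
    simp [hj]
  · simp

lemma measurable_moment (me : ∀ i, Measurable (e i)) {P : Ω → ℝ}
    (mP : Measurable P) (s : ι → ℝ) : Measurable (moment m e P s) := by
  have : StronglyMeasurable (Function.uncurry fun (g : ι → ℝ) (ω : Ω) => P ω * weight e s g ω) := by
    refine Measurable.stronglyMeasurable ?_
    unfold weight Function.uncurry
    fun_prop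
  exact this.integral_prod_right.measurable

lemma measurable_weight (me : ∀ i, Measurable (e i)) (s g : ι → ℝ) :
    Measurable (weight e s g) := by
  unfold weight
  fun_prop

lemma integrable_mul_weight (me : ∀ i, Measurable (e i)) (he : ∀ i ω, |e i ω| ≤ 1)
    {P : Ω → ℝ} (mP : Measurable P) {c : ℝ} (hP : ∀ ω, |P ω| ≤ c) (s g : ι → ℝ) :
    Integrable (fun ω => P ω * weight e s g ω) m := by
  obtain ⟨R, hR⟩ : ∃ R, ∀ i, |s i| ≤ R :=
    ⟨∑ i, |s i|, fun i => Finset.single_le_sum (f := fun i => |s i|) (fun _ _ => abs_nonneg _)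
      (Finset.mem_univ i)⟩
  refine Integrable.of_bound (mP.mul (measurable_weight me s g)).aestronglyMeasurable
    (c * Real.exp (R * ∑ i, |g i|)) (Filter.Eventually.of_forall fun ω => ?_)
  rw [Real.norm_eq_abs, abs_mul]
  have h := weight_le he hR (g := g) ω
  have h0 : 0 < weight e s g ω := Real.exp_pos _
  rw [abs_of_pos h0]
  exact mul_le_mul (hP ω) h h0.le ((abs_nonneg _).trans (hP ω))

lemma abs_moment_le (me : ∀ i, Measurable (e i)) (he : ∀ i ω, |e i ω| ≤ 1)
    {P : Ω → ℝ} (hP : ∀ ω, |P ω| ≤ 1) (s g : ι → ℝ) :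
    |moment m e P s g| ≤ moment m e 1 s g := by
  refine abs_integral_le_integral_abs.trans (integral_mono_of_nonneg
    (Filter.Eventually.of_forall fun _ => abs_nonneg _)
    (integrable_mul_weight me he measurable_one (c := 1) (by simp) s g)
    (Filter.Eventually.of_forall fun ω => ?_))
  have h0 : 0 < weight e s g ω := Real.exp_pos _
  simp only [abs_mul, abs_of_pos h0]
  exact mul_le_mul_of_nonneg_right (by simpa using hP ω) h0.le

lemma moment_one_le (me : ∀ i, Measurable (e i)) (he : ∀ i ω, |e i ω| ≤ 1) {s g : ι → ℝ} {R : ℝ}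
    (hs : ∀ i, |s i| ≤ R) : moment m e 1 s g ≤ m.real Set.univ * Real.exp (R * ∑ i, |g i|) := by
  have := integral_mono (integrable_mul_weight me he measurable_one (c := 1) (by simp) s g)
    (integrable_const (μ := m) (Real.exp (R * ∑ i, |g i|)))
    (fun ω => by simpa using weight_le he hs ω)
  simpa [moment] using this

lemma le_moment_one (me : ∀ i, Measurable (e i)) (he : ∀ i ω, |e i ω| ≤ 1) {s g : ι → ℝ} {R : ℝ}
    (hs : ∀ i, |s i| ≤ R) :
    m.real Set.univ * Real.exp (-(Fintype.card ι * (R ^ 2 / 2) + R * ∑ i, |g i|))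
      ≤ moment m e 1 s g := by
  have := integral_mono (integrable_const (μ := m)
    (Real.exp (-(Fintype.card ι * (R ^ 2 / 2) + R * ∑ i, |g i|))))
    (integrable_mul_weight me he measurable_one (c := 1) (by simp) s g)
    (fun ω => by simpa using le_weight he hs ω)
  simpa [moment] using this

lemma moment_one_pos [NeZero m] (me : ∀ i, Measurable (e i)) (he : ∀ i ω, |e i ω| ≤ 1)
    (s g : ι → ℝ) : 0 < moment m e 1 s g := by
  obtain ⟨R, hR⟩ : ∃ R, ∀ i, |s i| ≤ R :=
    ⟨∑ i, |s i|, fun i => Finset.single_le_sum (f := fun i => |s i|) (fun _ _ => abs_nonneg _)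
      (Finset.mem_univ i)⟩
  refine lt_of_lt_of_le ?_ (le_moment_one me he hR)
  have : 0 < m.real Set.univ := measureReal_univ_pos
  positivity

/-- A growth bound that serves all integrands of the argument. -/
lemma exists_moment_growth [NeZero m] (me : ∀ i, Measurable (e i)) (he : ∀ i ω, |e i ω| ≤ 1)
    (R : ℝ) : ∃ K κ : ℝ, ∀ s : ι → ℝ, (∀ i, |s i| ≤ R) → ∀ g,
      (moment m e 1 s g + (moment m e 1 s g)⁻¹ + 1) ^ 3 ≤ K * Real.exp (κ * ∑ i, |g i|) := by
  have hM : 0 < m.real Set.univ := measureReal_univ_pos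
  set M := m.real Set.univ
  set c : ℝ := Fintype.card ι * (R ^ 2 / 2)
  refine ⟨(M + M⁻¹ * Real.exp c + 1) ^ 3, 3 * |R|, fun s hs g => ?_⟩
  have hs' : ∀ i, |s i| ≤ |R| := fun i => (hs i).trans (le_abs_self R)
  have hpos := moment_one_pos (m := m) me he s g
  have h1 := moment_one_le (m := m) me he hs' (g := g)
  have h2 := inv_anti₀ (by positivity) (le_moment_one (m := m) me he hs' (g := g))
  rw [sq_abs, mul_inv, ← Real.exp_neg, neg_neg, Real.exp_add, ← mul_assoc] at h2
  have h3 : 1 ≤ Real.exp (|R| * ∑ i, |g i|) := Real.one_le_exp (by positivity)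
  have : Real.exp (3 * |R| * ∑ i, |g i|) = Real.exp (|R| * ∑ i, |g i|) ^ 3 := by
    rw [← Real.exp_nat_mul]; congr 1; push_cast; ring
  rw [this, ← mul_pow]
  refine pow_le_pow_left₀ (by positivity) ?_ 3
  calc _ ≤ M * Real.exp (|R| * ∑ i, |g i|) + M⁻¹ * Real.exp c * Real.exp (|R| * ∑ i, |g i|)
        + Real.exp (|R| * ∑ i, |g i|) := by gcongr
    _ = _ := by ring

end Moments

/-! ### The Itô formula for two moments -/

section Ito

variable {Ω ι : Type*} [MeasurableSpace Ω] [Fintype ι] [DecidableEq ι]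
  {m : Measure Ω} [IsFiniteMeasure m] [NeZero m] {e : ι → Ω → ℝ}

/-- The Itô formula for a function `G` of two moments. The moments are martingales in `s²`, so only
the second derivatives `Gaa`, `Gaz`, `Gzz` of `G` contribute to the drift. -/
lemma hasDerivAt_integral_comp_moment (me : ∀ i, Measurable (e i)) (he : ∀ i ω, |e i ω| ≤ 1)
    {P : Ω → ℝ} (mP : Measurable P) (hP : ∀ ω, |P ω| ≤ 1)
    {G Ga Gz Gaa Gaz Gzz : ℝ → ℝ → ℝ}
    (mG : Measurable fun q : ℝ × ℝ => G q.1 q.2) (mGa : Measurable fun q : ℝ × ℝ => Ga q.1 q.2)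
    (mGz : Measurable fun q : ℝ × ℝ => Gz q.1 q.2) (mGaa : Measurable fun q : ℝ × ℝ => Gaa q.1 q.2)
    (mGaz : Measurable fun q : ℝ × ℝ => Gaz q.1 q.2)
    (mGzz : Measurable fun q : ℝ × ℝ => Gzz q.1 q.2)
    (dG : ∀ (a z : ℝ → ℝ) (a' z' t : ℝ), HasDerivAt a a' t → HasDerivAt z z' t → 0 < z t →
      HasDerivAt (fun t => G (a t) (z t)) (Ga (a t) (z t) * a' + Gz (a t) (z t) * z') t)
    (dGa : ∀ (a z : ℝ → ℝ) (a' z' t : ℝ), HasDerivAt a a' t → HasDerivAt z z' t → 0 < z t →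
      HasDerivAt (fun t => Ga (a t) (z t)) (Gaa (a t) (z t) * a' + Gaz (a t) (z t) * z') t)
    (dGz : ∀ (a z : ℝ → ℝ) (a' z' t : ℝ), HasDerivAt a a' t → HasDerivAt z z' t → 0 < z t →
      HasDerivAt (fun t => Gz (a t) (z t)) (Gaz (a t) (z t) * a' + Gzz (a t) (z t) * z') t)
    (bG : ∀ a z, 0 < z → |a| ≤ z → |G a z| ≤ 2 * (z + z⁻¹ + 1) ^ 2)
    (bG' : ∀ a z, 0 < z → |a| ≤ z → ∀ H ∈ [Ga, Gz, Gaa, Gaz, Gzz], |H a z| ≤ 2 * (z + z⁻¹ + 1))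
    {s s' : ℝ → ι → ℝ} {t₀ ε R : ℝ} (hε : 0 < ε)
    (hs : ∀ t ∈ Metric.ball t₀ ε, ∀ i, HasDerivAt (fun t => s t i) (s' t i) t)
    (bs : ∀ t ∈ Metric.ball t₀ ε, ∀ i, |s t i| ≤ R)
    (bs' : ∀ t ∈ Metric.ball t₀ ε, ∀ i, |s' t i| ≤ R)
    {Q : ι → (ι → ℝ) → ℝ}
    (hQ : ∀ i g, Q i g =
      Gaa (moment m e P (s t₀) g) (moment m e 1 (s t₀) g)
          * moment m e (fun ω => P ω * e i ω) (s t₀) g ^ 2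
        + 2 * Gaz (moment m e P (s t₀) g) (moment m e 1 (s t₀) g)
          * moment m e (fun ω => P ω * e i ω) (s t₀) g * moment m e (e i) (s t₀) g
        + Gzz (moment m e P (s t₀) g) (moment m e 1 (s t₀) g) * moment m e (e i) (s t₀) g ^ 2) :
    (∀ i, Integrable (Q i) (gaussPi ι)) ∧
    HasDerivAt (fun t => ∫ g, G (moment m e P (s t) g) (moment m e 1 (s t) g) ∂(gaussPi ι))
      (∑ i, s' t₀ i * s t₀ i * ∫ g, Q i g ∂(gaussPi ι)) t₀ := by
  obtain ⟨K, κ, hK⟩ := exists_moment_growth (m := m) me he R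
  have ht₀ : t₀ ∈ Metric.ball t₀ ε := Metric.mem_ball_self hε
  have hPe : ∀ i ω, |P ω * e i ω| ≤ 1 := fun i ω => by
    rw [abs_mul]; exact mul_le_one₀ (hP ω) (abs_nonneg _) (he i ω)
  have he2 : ∀ i ω, |e i ω ^ 2| ≤ 1 := fun i ω => by
    rw [abs_pow]; exact pow_le_one₀ (abs_nonneg _) (he i ω)
  have hPe2 : ∀ i ω, |P ω * e i ω ^ 2| ≤ 1 := fun i ω => by
    rw [abs_mul]; exact mul_le_one₀ (hP ω) (abs_nonneg _) (he2 i ω)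
  have mM : ∀ {f : Ω → ℝ}, Measurable f → ∀ s, Measurable (moment m e f s) :=
    fun hf s => measurable_moment me hf s
  have mMP := mM mP
  have mM1 := mM (measurable_one (α := ℝ) (β := Ω))
  have mMe := fun i => mM (me i)
  have mMPe := fun i => mM (mP.mul (me i))
  have mMe2 := fun i => mM ((me i).pow_const 2)
  have mMPe2 := fun i => mM (mP.mul ((me i).pow_const 2))
  have mGc : ∀ {H : ℝ → ℝ → ℝ}, (Measurable fun q : ℝ × ℝ => H q.1 q.2) → ∀ s,
      Measurable fun g => H (moment m e P s g) (moment m e 1 s g) :=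
    fun hH s => hH.comp ((mMP s).prodMk (mM1 s))
  have pos := moment_one_pos (m := m) me he
  -- the moments that occur are bounded by the partition function
  have le1 : ∀ {f : Ω → ℝ}, (∀ ω, |f ω| ≤ 1) → ∀ s g,
      |moment m e f s g| ≤ moment m e 1 s g + (moment m e 1 s g)⁻¹ + 1 := fun hf s g =>
    (abs_moment_le me he hf s g).trans (by linarith [inv_pos.2 (pos s g)])
  have Y1 : ∀ s g, 1 ≤ moment m e 1 s g + (moment m e 1 s g)⁻¹ + 1 := fun s g => by
    linarith [inv_pos.2 (pos s g), pos s g]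
  have HG : ∀ s g, ∀ H ∈ [Ga, Gz, Gaa, Gaz, Gzz], |H (moment m e P s g) (moment m e 1 s g)|
      ≤ 2 * (moment m e 1 s g + (moment m e 1 s g)⁻¹ + 1) :=
    fun s g => bG' _ _ (pos s g) (abs_moment_le me he hP s g)
  have lin : ∀ {a b c d Y : ℝ}, 1 ≤ Y → |a| ≤ 2 * Y → |b| ≤ 2 * Y → |c| ≤ Y → |d| ≤ Y →
      |a * c + b * d| ≤ 4 * Y ^ 3 := by
    intro a b c d Y hY ha hb hc hd
    have h1 : |a * c| ≤ 2 * Y * Y := by rw [abs_mul]; gcongr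
    have h2 : |b * d| ≤ 2 * Y * Y := by rw [abs_mul]; gcongr
    have h3 : Y ^ 2 ≤ Y ^ 3 := pow_le_pow_right₀ hY (by norm_num)
    linarith [abs_add_le (a * c) (b * d)]
  have quad : ∀ {a b k c d Y : ℝ}, 1 ≤ Y → |a| ≤ 2 * Y → |b| ≤ 2 * Y → |k| ≤ 2 * Y → |c| ≤ Y →
      |d| ≤ Y → |a * c ^ 2 + 2 * b * c * d + k * d ^ 2| ≤ 8 * Y ^ 3 := by
    intro a b k c d Y hY ha hb hk hc hd
    have h1 : |a * c ^ 2| ≤ 2 * Y * Y ^ 2 := by rw [abs_mul, abs_pow]; gcongr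
    have h2 : |2 * b * c * d| ≤ 2 * (2 * Y) * Y * Y := by
      rw [abs_mul, abs_mul, abs_mul, abs_two]; gcongr
    have h3 : |k * d ^ 2| ≤ 2 * Y * Y ^ 2 := by rw [abs_mul, abs_pow]; gcongr
    linarith [abs_add_le (a * c ^ 2 + 2 * b * c * d) (k * d ^ 2),
      abs_add_le (a * c ^ 2) (2 * b * c * d)]
  let A : ι → ℝ → (ι → ℝ) → ℝ := fun i t g =>
    Ga (moment m e P (s t) g) (moment m e 1 (s t) g) * moment m e (fun ω => P ω * e i ω) (s t) g
      + Gz (moment m e P (s t) g) (moment m e 1 (s t) g) * moment m e (e i) (s t) g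
  let B : ι → ℝ → (ι → ℝ) → ℝ := fun i t g =>
    Ga (moment m e P (s t) g) (moment m e 1 (s t) g) * moment m e (fun ω => P ω * e i ω ^ 2) (s t) g
      + Gz (moment m e P (s t) g) (moment m e 1 (s t) g) * moment m e (fun ω => e i ω ^ 2) (s t) g
  have bA : ∀ i, ∀ t ∈ Metric.ball t₀ ε, ∀ g,
      |A i t g| ≤ 12 * K * Real.exp (κ * ∑ i, |g i|) := fun i t ht g => by
    have := lin (Y1 (s t) g) (HG (s t) g Ga (by simp)) (HG (s t) g Gz (by simp))
      (le1 (hPe i) (s t) g) (le1 (he i) (s t) g)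
    have h3 := hK (s t) (bs t ht) g
    have h0 : 0 ≤ (moment m e 1 (s t) g + (moment m e 1 (s t) g)⁻¹ + 1) ^ 3 :=
      pow_nonneg (zero_le_one.trans (Y1 _ _)) 3
    change |_ + _| ≤ _
    linarith
  have bB : ∀ i, ∀ t ∈ Metric.ball t₀ ε, ∀ g,
      |B i t g| ≤ 4 * (K * Real.exp (κ * ∑ i, |g i|)) := fun i t ht g => by
    have := lin (Y1 (s t) g) (HG (s t) g Ga (by simp)) (HG (s t) g Gz (by simp))
      (le1 (hPe2 i) (s t) g) (le1 (he2 i) (s t) g)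
    have h3 := hK (s t) (bs t ht) g
    change |_ + _| ≤ _
    linarith
  have bQ : ∀ i g, |Q i g| ≤ 8 * (K * Real.exp (κ * ∑ i, |g i|)) := fun i g => by
    have := quad (Y1 (s t₀) g) (HG (s t₀) g Gaa (by simp)) (HG (s t₀) g Gaz (by simp))
      (HG (s t₀) g Gzz (by simp)) (le1 (hPe i) (s t₀) g) (le1 (he i) (s t₀) g)
    have h3 := hK (s t₀) (bs t₀ ht₀) g
    rw [hQ]
    linarith
  have K0 : ∀ g : ι → ℝ, 0 ≤ K * Real.exp (κ * ∑ i, |g i|) := fun g =>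
    (pow_nonneg (zero_le_one.trans (Y1 _ _)) 3).trans (hK (s t₀) (bs t₀ ht₀) g)
  have mA : ∀ i t, Measurable (A i t) := fun i t =>
    ((mGc mGa (s t)).mul (mMPe i (s t))).add ((mGc mGz (s t)).mul (mMe i (s t)))
  have mB : ∀ i t, Measurable (B i t) := fun i t =>
    ((mGc mGa (s t)).mul (mMPe2 i (s t))).add ((mGc mGz (s t)).mul (mMe2 i (s t)))
  have mQ : ∀ i, Measurable (Q i) := fun i => by
    rw [funext (hQ i)]
    exact (((mGc mGaa (s t₀)).mul ((mMPe i (s t₀)).pow_const 2)).add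
      ((((mGc mGaz (s t₀)).const_mul 2).mul (mMPe i (s t₀))).mul (mMe i (s t₀)))).add
      ((mGc mGzz (s t₀)).mul ((mMe i (s t₀)).pow_const 2))
  refine ⟨fun i => integrable_gaussPi_of_le (mQ i) (K := 8 * K) (κ := κ)
    fun g => by rw [mul_assoc]; exact bQ i g, ?_⟩
  have main := hasDerivAt_integral_gaussPi
    (Ψ := fun t g => G (moment m e P (s t) g) (moment m e 1 (s t) g))
    (A := A) (B := B) (C := fun i g => Q i g + B i t₀ g) (s := s) (s' := s') (t₀ := t₀)
    (K := 12 * K) (κ := κ) (R := R) hε (fun t => mGc mG (s t)) mA mB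
    (fun i => (mQ i).add (mB i t₀)) ?_ bA ?_ ?_ bs bs' ?_ ?_
  · simpa only [add_sub_cancel_right] using main
  · intro g
    have h1 := bG _ _ (pos (s t₀) g) (abs_moment_le me he hP (s t₀) g)
    have h2 := hK (s t₀) (bs t₀ ht₀) g
    have h3 := pow_le_pow_right₀ (Y1 (s t₀) g) (show 2 ≤ 3 by norm_num)
    linarith [K0 g]
  · intro i t ht g
    linarith [bB i t ht g, K0 g]
  · intro i g
    linarith [bB i t₀ ht₀ g, bQ i g, abs_add_le (Q i g) (B i t₀ g)]
  · intro g t ht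
    have h1 := hasDerivAt_moment_time (m := m) me he mP hP (hs t ht) g
    have h2 := hasDerivAt_moment_time (m := m) me he measurable_one (P := 1) (by simp) (hs t ht) g
    refine (dG _ _ _ _ t h1 h2 (pos _ _)).congr_deriv ?_
    simp only [Pi.one_apply, one_mul]
    rw [Finset.mul_sum, Finset.mul_sum, ← Finset.sum_add_distrib]
    refine Finset.sum_congr rfl fun i _ => ?_
    simp only [A, B]
    ring
  · intro i g z
    have h1 := hasDerivAt_moment_update (m := m) me he mP hP (s t₀) g i z
    have h2 := hasDerivAt_moment_update (m := m) me he measurable_one (P := 1) (by simp) (s t₀) g i z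
    have h3 := hasDerivAt_moment_update (m := m) me he (mP.mul (me i)) (hPe i) (s t₀) g i z
    have h4 := hasDerivAt_moment_update (m := m) me he (me i) (he i) (s t₀) g i z
    have e1 : (fun ω => P ω * e i ω * e i ω) = fun ω => P ω * e i ω ^ 2 := by ext ω; ring
    have e2 : (fun ω => e i ω * e i ω) = fun ω => e i ω ^ 2 := by ext ω; ring
    have e3 : (fun ω => (1 : Ω → ℝ) ω * e i ω) = e i := by ext ω; simp
    simp only [Pi.mul_apply, e1] at h3
    change HasDerivAt (fun z => moment m e (fun ω => P ω * e i ω) (s t₀) (Function.update g i z)) _ z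
      at h3
    rw [e2] at h4
    rw [e3] at h2
    refine (((dGa _ _ _ _ z h1 h2 (pos _ _)).mul h3).add
      ((dGz _ _ _ _ z h1 h2 (pos _ _)).mul h4)).congr_deriv ?_
    simp only [hQ, B]
    ring

end Ito

/-! ### Convexity of the observation entropy -/

section Entropy

variable {Ω ι : Type*} [MeasurableSpace Ω] [Fintype ι] {m : Measure Ω} [IsFiniteMeasure m]
  {e : ι → Ω → ℝ}

/-- The posterior covariance matrix of the signal is positive semidefinite. -/
lemma posSemidef_covariance [NeZero m] (me : ∀ i, Measurable (e i)) (he : ∀ i ω, |e i ω| ≤ 1)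
    (s g : ι → ℝ) : (Matrix.of fun i j => moment m e (fun ω => e i ω * e j ω) s g
      - moment m e (e i) s g * moment m e (e j) s g / moment m e 1 s g).PosSemidef := by
  have hpos := moment_one_pos (m := m) me he s g
  set Z := moment m e 1 s g with hZ
  have hb : ∀ i j ω, |e i ω * e j ω| ≤ 1 := fun i j ω => by
    rw [abs_mul]; exact mul_le_one₀ (he i ω) (abs_nonneg _) (he j ω)
  have i1 : ∀ i, Integrable (fun ω => e i ω * weight e s g ω) m := fun i =>
    integrable_mul_weight me he (me i) (he i) s g
  have i2 : ∀ i j, Integrable (fun ω => e i ω * e j ω * weight e s g ω) m := fun i j =>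
    integrable_mul_weight me he ((me i).mul (me j)) (hb i j) s g
  have i0 : Integrable (fun ω => weight e s g ω) m := by
    simpa using integrable_mul_weight (m := m) me he measurable_one (c := 1) (by simp) s g
  refine Matrix.PosSemidef.of_dotProduct_mulVec_nonneg ?_ fun v => ?_
  · ext i j
    simp only [Matrix.conjTranspose_apply, Matrix.of_apply, star_trivial]
    simp_rw [mul_comm (e j _) (e i _), mul_comm (moment m e (e j) s g)]
  set a := ∑ i, v i * moment m e (e i) s g with ha
  -- the quadratic form is the weighted variance of `∑ v_i e_i`
  have key : ∫ ω, (∑ i, v i * e i ω - a / Z) ^ 2 * weight e s g ω ∂m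
      = ∑ i, ∑ j, v i * v j * moment m e (fun ω => e i ω * e j ω) s g - a ^ 2 / Z := by
    have hexp : ∀ ω, (∑ i, v i * e i ω - a / Z) ^ 2 * weight e s g ω
        = (∑ i, ∑ j, v i * v j * (e i ω * e j ω * weight e s g ω))
          - 2 * (a / Z) * (∑ i, v i * (e i ω * weight e s g ω))
          + (a / Z) ^ 2 * weight e s g ω := by
      intro ω
      have h1 : ∑ i, ∑ j, v i * v j * (e i ω * e j ω * weight e s g ω)
          = (∑ i, v i * e i ω) ^ 2 * weight e s g ω := by
        rw [sq, Finset.sum_mul_sum, Finset.sum_mul]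
        refine Finset.sum_congr rfl fun i _ => ?_
        rw [Finset.sum_mul]
        exact Finset.sum_congr rfl fun j _ => by ring
      have h2 : ∑ i, v i * (e i ω * weight e s g ω) = (∑ i, v i * e i ω) * weight e s g ω := by
        rw [Finset.sum_mul]
        exact Finset.sum_congr rfl fun i _ => by ring
      rw [h1, h2]
      ring
    simp_rw [hexp]
    have I2 : Integrable (fun ω => ∑ i, ∑ j, v i * v j * (e i ω * e j ω * weight e s g ω)) m :=
      integrable_finsetSum _ fun i _ => integrable_finsetSum _ fun j _ => (i2 i j).const_mul _
    have I1 : Integrable (fun ω => 2 * (a / Z) * ∑ i, v i * (e i ω * weight e s g ω)) m :=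
      (integrable_finsetSum _ fun i _ => (i1 i).const_mul _).const_mul _
    have I21 : Integrable (fun ω => ∑ i, ∑ j, v i * v j * (e i ω * e j ω * weight e s g ω)
        - 2 * (a / Z) * ∑ i, v i * (e i ω * weight e s g ω)) m := I2.sub I1
    rw [integral_add I21 (i0.const_mul _), integral_sub I2 I1, integral_const_mul,
      integral_const_mul, integral_finsetSum _ fun i _ => (i1 i).const_mul _,
      integral_finsetSum _ fun i _ => integrable_finsetSum _ fun j _ => (i2 i j).const_mul _]
    have e0 : ∫ ω, weight e s g ω ∂m = Z := by simp [hZ, moment]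
    have e1 : ∑ i, ∫ ω, v i * (e i ω * weight e s g ω) ∂m = a := by
      simp_rw [integral_const_mul]
      rfl
    have e2 : ∑ i, ∫ ω, ∑ j, v i * v j * (e i ω * e j ω * weight e s g ω) ∂m
        = ∑ i, ∑ j, v i * v j * moment m e (fun ω => e i ω * e j ω) s g := by
      refine Finset.sum_congr rfl fun i _ => ?_
      rw [integral_finsetSum _ fun j _ => (i2 i j).const_mul _]
      simp_rw [integral_const_mul]
      rfl
    rw [e0, e1, e2]
    field_simp
    ring
  have hnn : 0 ≤ ∫ ω, (∑ i, v i * e i ω - a / Z) ^ 2 * weight e s g ω ∂m :=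
    integral_nonneg fun ω => mul_nonneg (sq_nonneg _) (Real.exp_pos _).le
  rw [key] at hnn
  refine hnn.trans_eq ?_
  have h3 : a ^ 2 / Z = ∑ i, ∑ j, v i * v j *
      (moment m e (e i) s g * moment m e (e j) s g / Z) := by
    rw [ha, sq, Finset.sum_mul_sum, Finset.sum_div]
    refine Finset.sum_congr rfl fun i _ => ?_
    rw [Finset.sum_div]
    exact Finset.sum_congr rfl fun j _ => by ring
  rw [h3, ← Finset.sum_sub_distrib]
  simp only [dotProduct, Matrix.mulVec, Pi.star_apply, star_trivial, Matrix.of_apply]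
  refine Finset.sum_congr rfl fun i _ => ?_
  rw [← Finset.sum_sub_distrib, Finset.mul_sum]
  exact Finset.sum_congr rfl fun j _ => by ring

/-- The expected value of `Z log Z` for the likelihood ratio `Z`, averaged over the prior `m`, of an
observation with signal-to-noise ratios `x`, under pure noise. For a probability measure `m` this
is the relative entropy of the observation with respect to the noise. -/
noncomputable def observationEntropy (m : Measure Ω) (e : ι → Ω → ℝ) (x : ι → ℝ) : ℝ :=
  ∫ g, moment m e 1 (fun i => √(x i)) g * Real.log (moment m e 1 (fun i => √(x i)) g) ∂(gaussPi ι)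

lemma abs_log_le {z : ℝ} (hz : 0 < z) : |Real.log z| ≤ z + z⁻¹ := by
  rw [abs_le]
  constructor
  · have := Real.log_le_sub_one_of_pos (inv_pos.2 hz)
    rw [Real.log_inv] at this
    linarith
  · linarith [Real.log_le_sub_one_of_pos hz, inv_pos.2 hz]

lemma abs_mul_log_le {z : ℝ} (hz : 0 < z) : |z * Real.log z| ≤ 2 * (z + z⁻¹ + 1) ^ 2 := by
  have h := abs_log_le hz
  have h0 := inv_pos.2 hz
  rw [abs_mul, abs_of_pos hz]
  calc z * |Real.log z| ≤ z * (z + z⁻¹) := by gcongr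
    _ ≤ 2 * (z + z⁻¹ + 1) ^ 2 := by nlinarith [mul_pos hz h0]

lemma continuous_moment (me : ∀ i, Measurable (e i)) (he : ∀ i ω, |e i ω| ≤ 1) (g : ι → ℝ) :
    Continuous fun s => moment m e 1 s g := by
  refine continuous_iff_continuousAt.2 fun s₀ => ?_
  refine continuousAt_of_dominated (bound := fun _ => Real.exp ((‖s₀‖ + 1) * ∑ i, |g i|))
    (Filter.Eventually.of_forall fun s =>
      (measurable_one.mul (measurable_weight me s g)).aestronglyMeasurable) ?_
    (integrable_const _) (Filter.Eventually.of_forall fun ω => ?_)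
  · filter_upwards [Metric.ball_mem_nhds s₀ one_pos] with s hs
    refine Filter.Eventually.of_forall fun ω => ?_
    have h0 : 0 < weight e s g ω := Real.exp_pos _
    rw [Pi.one_apply, one_mul, Real.norm_eq_abs, abs_of_pos h0]
    refine weight_le he (fun i => ?_) ω
    have h1 : ‖s - s₀‖ < 1 := by rwa [← dist_eq_norm]
    have h2 := norm_le_pi_norm s i
    have h3 := norm_sub_norm_le s s₀
    rw [Real.norm_eq_abs] at h2
    linarith
  · unfold weight
    fun_prop

lemma continuous_observationEntropy [NeZero m] (me : ∀ i, Measurable (e i))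
    (he : ∀ i ω, |e i ω| ≤ 1) : Continuous (observationEntropy m e) := by
  refine continuous_iff_continuousAt.2 fun x₀ => ?_
  have hs : Continuous fun (x : ι → ℝ) (i : ι) => √(x i) := by fun_prop
  obtain ⟨K, κ, hK⟩ := exists_moment_growth (m := m) me he (‖fun i => √(x₀ i)‖ + 1)
  refine continuousAt_of_dominated
    (bound := fun g => 2 * (K * Real.exp (κ * ∑ i, |g i|)))
    (Filter.Eventually.of_forall fun x => ?_) ?_
    (((integrable_exp_mul_sum_abs κ).const_mul K).const_mul 2)
    (Filter.Eventually.of_forall fun g => ?_)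
  · have := measurable_moment (m := m) me (measurable_one (α := ℝ) (β := Ω)) fun i => √(x i)
    exact (this.mul (Real.measurable_log.comp this)).aestronglyMeasurable
  · filter_upwards [hs.continuousAt.preimage_mem_nhds (Metric.ball_mem_nhds _ one_pos)] with x hx
    refine Filter.Eventually.of_forall fun g => ?_
    have hR : ∀ i, |√(x i)| ≤ ‖fun i => √(x₀ i)‖ + 1 := fun i => by
      have h1 : ‖(fun i => √(x i)) - fun i => √(x₀ i)‖ < 1 := by rw [← dist_eq_norm]; exact hx
      have h2 := norm_le_pi_norm (fun i => √(x i)) i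
      have h3 := norm_sub_norm_le (fun i => √(x i)) fun i => √(x₀ i)
      rw [Real.norm_eq_abs] at h2
      linarith
    have hpos := moment_one_pos (m := m) me he (fun i => √(x i)) g
    have h1 := abs_mul_log_le hpos
    have h2 := hK _ hR g
    have h3 := pow_le_pow_right₀ (show 1 ≤ moment m e 1 (fun i => √(x i)) g
      + (moment m e 1 (fun i => √(x i)) g)⁻¹ + 1 by linarith [inv_pos.2 hpos])
      (show 2 ≤ 3 by norm_num)
    rw [Real.norm_eq_abs]
    linarith
  · have hc : Continuous fun x : ι → ℝ => moment m e 1 (fun i => √(x i)) g :=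
      (continuous_moment me he g).comp hs
    exact (hc.mul (hc.log fun x => (moment_one_pos me he _ g).ne')).continuousAt

/-- The Hessian of the observation entropy is an average of Hadamard squares of posterior
covariance matrices, so the entropy is convex along segments of the open orthant. -/
lemma convexOn_observationEntropy_segment [NeZero m] (me : ∀ i, Measurable (e i))
    (he : ∀ i ω, |e i ω| ≤ 1) {u v : ι → ℝ} (hu : ∀ i, 0 < u i) (hv : ∀ i, 0 < v i) :
    ConvexOn ℝ (Set.Icc 0 1)
      fun t : ℝ => observationEntropy m e fun i => u i + t * (v i - u i) := by
  classical
  set s : ℝ → ι → ℝ := fun t i => √(u i + t * (v i - u i)) with hsdef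
  set s' : ℝ → ι → ℝ := fun t i => (v i - u i) / (2 * s t i) with hs'def
  set M : (Ω → ℝ) → ℝ → (ι → ℝ) → ℝ := fun P t g => moment m e P (s t) g with hM
  have pos : ∀ t g, 0 < M 1 t g := fun t g => moment_one_pos me he _ _
  have hmin : ∀ t ∈ Set.Ioo (0 : ℝ) 1, ∀ i, min (u i) (v i) ≤ u i + t * (v i - u i) := by
    intro t ht i
    rcases le_total (u i) (v i) with h | h
    · rw [min_eq_left h]; nlinarith [ht.1]
    · rw [min_eq_right h]; nlinarith [ht.2]
  have hxpos : ∀ t ∈ Set.Ioo (0 : ℝ) 1, ∀ i, 0 < u i + t * (v i - u i) := fun t ht i =>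
    (lt_min (hu i) (hv i)).trans_le (hmin t ht i)
  have hspos : ∀ t ∈ Set.Ioo (0 : ℝ) 1, ∀ i, 0 < s t i := fun t ht i =>
    Real.sqrt_pos.2 (hxpos t ht i)
  have hds : ∀ t ∈ Set.Ioo (0 : ℝ) 1, ∀ i, HasDerivAt (fun t => s t i) (s' t i) t := by
    intro t ht i
    have h := ((hasDerivAt_id t).mul_const (v i - u i)).const_add (u i)
    refine (h.sqrt (hxpos t ht i).ne').congr_deriv ?_
    rw [one_mul]
    rfl
  have hss : ∀ t ∈ Set.Ioo (0 : ℝ) 1, ∀ i, s' t i * s t i = (v i - u i) / 2 := by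
    intro t ht i
    have := (hspos t ht i).ne'
    simp only [hs'def]
    field_simp
  obtain ⟨R, hR, hR'⟩ : ∃ R, (∀ t ∈ Set.Ioo (0 : ℝ) 1, ∀ i, |s t i| ≤ R) ∧
      ∀ t ∈ Set.Ioo (0 : ℝ) 1, ∀ i, |s' t i| ≤ R := by
    have hle : ∀ c : ι → ℝ, (∀ i, 0 ≤ c i) → ∀ i, c i ≤ ∑ i, c i := fun c hc i =>
      Finset.single_le_sum (fun j _ => hc j) (Finset.mem_univ i)
    refine ⟨∑ i, √(max (u i) (v i)) + ∑ i, |v i - u i| / (2 * √(min (u i) (v i))),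
      fun t ht i => ?_, fun t ht i => ?_⟩
    · rw [abs_of_pos (hspos t ht i)]
      have h1 : s t i ≤ √(max (u i) (v i)) := by
        refine Real.sqrt_le_sqrt ?_
        rcases le_total (u i) (v i) with h | h
        · rw [max_eq_right h]; nlinarith [ht.2]
        · rw [max_eq_left h]; nlinarith [ht.1]
      exact (h1.trans (hle (fun i => √(max (u i) (v i))) (fun _ => Real.sqrt_nonneg _) i)).trans
        (le_add_of_nonneg_right (Finset.sum_nonneg fun _ _ => by positivity))
    · have h0 := lt_min (hu i) (hv i)
      have h1 : |s' t i| ≤ |v i - u i| / (2 * √(min (u i) (v i))) := by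
        simp only [hs'def]
        rw [abs_div, abs_of_pos (mul_pos two_pos (hspos t ht i))]
        have := Real.sqrt_pos.2 h0
        gcongr
        exact Real.sqrt_le_sqrt (hmin t ht i)
      exact (h1.trans (hle (fun i => |v i - u i| / (2 * √(min (u i) (v i))))
        (fun _ => by positivity) i)).trans
        (le_add_of_nonneg_left (Finset.sum_nonneg fun _ _ => Real.sqrt_nonneg _))
  have hball : ∀ t ∈ Set.Ioo (0 : ℝ) 1, ∃ ε > 0, Metric.ball t ε ⊆ Set.Ioo 0 1 := fun t ht =>
    Metric.isOpen_iff.1 isOpen_Ioo t ht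
  -- the first derivative, from the Itô formula for `z log z`
  have first : ∀ t ∈ Set.Ioo (0 : ℝ) 1,
      HasDerivAt (fun t => ∫ g, M 1 t g * Real.log (M 1 t g) ∂(gaussPi ι))
        (∑ i, (v i - u i) / 2 * ∫ g, M (e i) t g ^ 2 / M 1 t g ∂(gaussPi ι)) t := by
    intro t ht
    obtain ⟨ε, hε, hsub⟩ := hball t ht
    have h := (hasDerivAt_integral_comp_moment (m := m) me he (P := 1) measurable_one (by simp)
      (G := fun _ z => z * Real.log z) (Ga := fun _ _ => 0) (Gz := fun _ z => Real.log z + 1)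
      (Gaa := fun _ _ => 0) (Gaz := fun _ _ => 0) (Gzz := fun _ z => z⁻¹)
      (by fun_prop) (by fun_prop) (by fun_prop) (by fun_prop) (by fun_prop) (by fun_prop)
      (fun a z a' z' t _ hz h0 => by
        refine (hz.mul (hz.log h0.ne')).congr_deriv ?_
        have := h0.ne'
        field_simp
        ring)
      (fun a z a' z' t _ _ _ => by simpa using hasDerivAt_const t (0 : ℝ))
      (fun a z a' z' t _ hz h0 => by
        refine ((hz.log h0.ne').add_const 1).congr_deriv ?_
        have := h0.ne'
        field_simp
        ring)
      (fun a z hz _ => abs_mul_log_le hz)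
      (fun a z hz _ H hH => by
        have h0 := inv_pos.2 hz
        simp only [List.mem_cons, List.not_mem_nil, or_false] at hH
        rcases hH with rfl | rfl | rfl | rfl | rfl
        · rw [abs_zero]; positivity
        · have := abs_add_le (Real.log z) 1
          rw [abs_one] at this
          linarith [abs_log_le hz]
        · rw [abs_zero]; positivity
        · rw [abs_zero]; positivity
        · rw [abs_of_pos h0]; linarith)
      hε (fun r hr => hds r (hsub hr)) (fun r hr => hR r (hsub hr)) (fun r hr => hR' r (hsub hr))
      (Q := fun i g => M (e i) t g ^ 2 / M 1 t g)
      (fun i g => by simp only [hM, zero_mul, mul_zero, zero_add]; ring)).2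
    refine h.congr_deriv (Finset.sum_congr rfl fun i _ => ?_)
    rw [hss t ht i]
  -- the second derivative, from the Itô formula for `a² / z`
  set Q : ι → ι → ℝ → (ι → ℝ) → ℝ := fun i j t g => 2 * (M 1 t g)⁻¹ *
    (M (fun ω => e i ω * e j ω) t g - M (e i) t g * M (e j) t g / M 1 t g) ^ 2 with hQ
  have second : ∀ i, ∀ t ∈ Set.Ioo (0 : ℝ) 1, (∀ j, Integrable (Q i j t) (gaussPi ι)) ∧
      HasDerivAt (fun t => ∫ g, M (e i) t g ^ 2 / M 1 t g ∂(gaussPi ι))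
        (∑ j, (v j - u j) / 2 * ∫ g, Q i j t g ∂(gaussPi ι)) t := by
    intro i t ht
    obtain ⟨ε, hε, hsub⟩ := hball t ht
    have h := hasDerivAt_integral_comp_moment (m := m) me he (P := e i) (me i) (he i)
      (G := fun a z => a ^ 2 / z) (Ga := fun a z => 2 * a / z) (Gz := fun a z => -(a ^ 2 / z ^ 2))
      (Gaa := fun _ z => 2 / z) (Gaz := fun a z => -(2 * a / z ^ 2))
      (Gzz := fun a z => 2 * a ^ 2 / z ^ 3)
      (by fun_prop) (by fun_prop) (by fun_prop) (by fun_prop) (by fun_prop) (by fun_prop)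
      (fun a z a' z' t ha hz h0 => by
        refine ((ha.pow 2).div hz h0.ne').congr_deriv ?_
        have := h0.ne'
        simp only [Pi.pow_apply]
        field_simp
        push_cast
        ring)
      (fun a z a' z' t ha hz h0 => by
        refine ((ha.const_mul 2).div hz h0.ne').congr_deriv ?_
        have := h0.ne'
        field_simp
        ring)
      (fun a z a' z' t ha hz h0 => by
        refine ((ha.pow 2).div (hz.pow 2) (pow_ne_zero 2 h0.ne')).neg.congr_deriv ?_
        have := h0.ne'
        simp only [Pi.pow_apply]
        field_simp
        push_cast
        ring)
      (fun a z hz ha => by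
        have h0 := inv_pos.2 hz
        rw [abs_div, abs_pow, abs_of_pos hz, div_le_iff₀ hz]
        calc |a| ^ 2 ≤ z ^ 2 := by gcongr
          _ ≤ 2 * (z + z⁻¹ + 1) ^ 2 * z := by nlinarith [mul_pos hz h0, mul_pos hz hz])
      (fun a z hz ha H hH => by
        have h0 := inv_pos.2 hz
        have hr : |a| / z ≤ 1 := (div_le_one hz).2 ha
        have hr0 : 0 ≤ |a| / z := by positivity
        have hr2 : (|a| / z) ^ 2 ≤ 1 := pow_le_one₀ hr0 hr
        simp only [List.mem_cons, List.not_mem_nil, or_false] at hH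
        rcases hH with rfl | rfl | rfl | rfl | rfl
        · have : |2 * a / z| = 2 * (|a| / z) := by
            rw [abs_div, abs_mul, abs_two, abs_of_pos hz, mul_div_assoc]
          linarith
        · have : |-(a ^ 2 / z ^ 2)| = (|a| / z) ^ 2 := by
            rw [abs_neg, ← div_pow, abs_pow, abs_div, abs_of_pos hz]
          linarith
        · have : |2 / z| = 2 * z⁻¹ := by rw [abs_div, abs_two, abs_of_pos hz, div_eq_mul_inv]
          linarith
        · have : |-(2 * a / z ^ 2)| = 2 * (|a| / z) * z⁻¹ := by
            rw [abs_neg, abs_div, abs_mul, abs_two, abs_pow, abs_of_pos hz]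
            field_simp
          nlinarith
        · have : |2 * a ^ 2 / z ^ 3| = 2 * (|a| / z) ^ 2 * z⁻¹ := by
            rw [abs_div, abs_mul, abs_two, abs_pow, abs_pow, abs_of_pos hz]
            field_simp
          nlinarith)
      hε (fun r hr => hds r (hsub hr)) (fun r hr => hR r (hsub hr)) (fun r hr => hR' r (hsub hr))
      (Q := fun j g => Q i j t g)
      (fun j g => by
        have := (pos t g).ne'
        simp only [hQ, hM] at this ⊢
        field_simp
        ring)
    refine ⟨h.1, h.2.congr_deriv (Finset.sum_congr rfl fun j _ => ?_)⟩
    rw [hss t ht j]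
  have hcont : Continuous fun t : ℝ => observationEntropy m e fun i => u i + t * (v i - u i) :=
    (continuous_observationEntropy me he).comp (by fun_prop)
  refine convexOn_of_hasDerivWithinAt2_nonneg (convex_Icc 0 1) hcont.continuousOn
    (f' := fun t => ∑ i, (v i - u i) / 2 * ∫ g, M (e i) t g ^ 2 / M 1 t g ∂(gaussPi ι))
    (f'' := fun t => ∑ i, (v i - u i) / 2 * ∑ j, (v j - u j) / 2 * ∫ g, Q i j t g ∂(gaussPi ι))
    ?_ ?_ ?_
  · rw [interior_Icc]
    exact fun t ht => (first t ht).hasDerivWithinAt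
  · rw [interior_Icc]
    exact fun t ht => (HasDerivAt.fun_sum fun i _ =>
      ((second i t ht).2.const_mul _)).hasDerivWithinAt
  · rw [interior_Icc]
    intro t ht
    have hrw : ∑ i, (v i - u i) / 2 * ∑ j, (v j - u j) / 2 * ∫ g, Q i j t g ∂(gaussPi ι)
        = ∫ g, ∑ i, ∑ j, (v i - u i) / 2 * ((v j - u j) / 2) * Q i j t g ∂(gaussPi ι) := by
      have hi := fun i j => ((second i t ht).1 j).const_mul ((v i - u i) / 2 * ((v j - u j) / 2))
      rw [integral_finsetSum _ fun i _ => integrable_finsetSum _ fun j _ => hi i j]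
      refine Finset.sum_congr rfl fun i _ => ?_
      rw [integral_finsetSum _ fun j _ => hi i j, Finset.mul_sum]
      refine Finset.sum_congr rfl fun j _ => ?_
      rw [integral_const_mul, mul_assoc]
    rw [hrw]
    refine integral_nonneg fun g => ?_
    have psd := posSemidef_covariance (m := m) me he (s t) g
    have had := (psd.hadamard psd).dotProduct_mulVec_nonneg fun i => (v i - u i) / 2
    have h2 : ∑ i, ∑ j, (v i - u i) / 2 * ((v j - u j) / 2) * Q i j t g
        = 2 * (M 1 t g)⁻¹ * ∑ i, ∑ j, (v i - u i) / 2 * ((v j - u j) / 2) *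
          (M (fun ω => e i ω * e j ω) t g - M (e i) t g * M (e j) t g / M 1 t g) ^ 2 := by
      rw [Finset.mul_sum]
      refine Finset.sum_congr rfl fun i _ => ?_
      rw [Finset.mul_sum]
      exact Finset.sum_congr rfl fun j _ => by simp only [hQ]; ring
    change 0 ≤ ∑ i, ∑ j, (v i - u i) / 2 * ((v j - u j) / 2) * Q i j t g
    rw [h2]
    refine mul_nonneg (mul_nonneg zero_le_two (inv_nonneg.2 (pos t g).le)) (had.trans_eq ?_)
    simp only [dotProduct, Matrix.mulVec, Pi.star_apply, star_trivial, Matrix.hadamard_apply,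
      Matrix.of_apply, hM]
    refine Finset.sum_congr rfl fun i _ => ?_
    rw [Finset.mul_sum]
    exact Finset.sum_congr rfl fun j _ => by ring

theorem convexOn_observationEntropy [NeZero m] (me : ∀ i, Measurable (e i))
    (he : ∀ i ω, |e i ω| ≤ 1) :
    ConvexOn ℝ {x : ι → ℝ | ∀ i, 0 ≤ x i} (observationEntropy m e) := by
  have hconv : Convex ℝ {x : ι → ℝ | ∀ i, 0 ≤ x i} := convex_Ici (0 : ι → ℝ)
  refine ⟨hconv, fun u hu v hv a b ha hb hab => ?_⟩
  have hc := continuous_observationEntropy (m := m) me he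
  -- the open orthant is handled along segments, its boundary by the shift `ε → 0`
  have key : ∀ ε ∈ Set.Ioi (0 : ℝ), observationEntropy m e (fun i => (a • u + b • v) i + ε)
      ≤ a • observationEntropy m e (fun i => u i + ε)
        + b • observationEntropy m e (fun i => v i + ε) := by
    intro ε hε
    have h := (convexOn_observationEntropy_segment (m := m) me he (u := fun i => u i + ε)
      (v := fun i => v i + ε) (fun i => add_pos_of_nonneg_of_pos (hu i) hε)
      (fun i => add_pos_of_nonneg_of_pos (hv i) hε)).2 (x := 0) (by simp) (y := 1) (by simp)
      ha hb hab
    simp only [smul_eq_mul, mul_zero, mul_one, zero_add, zero_mul, add_zero, one_mul,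
      add_sub_cancel] at h
    refine le_of_eq_of_le (congrArg _ ?_) h
    ext i
    have : a = 1 - b := by linarith
    simp only [Pi.add_apply, Pi.smul_apply, smul_eq_mul, this]
    ring
  have lim : ∀ x : ι → ℝ, Filter.Tendsto (fun ε : ℝ => observationEntropy m e fun i => x i + ε)
      (nhdsWithin 0 (Set.Ioi 0)) (nhds (observationEntropy m e x)) := by
    intro x
    have h : Continuous fun ε : ℝ => observationEntropy m e fun i => x i + ε :=
      hc.comp (by fun_prop)
    simpa using (h.tendsto 0).mono_left nhdsWithin_le_nhds
  exact le_of_tendsto_of_tendsto (lim (a • u + b • v))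
    (((lim u).const_smul a).add ((lim v).const_smul b))
    (eventually_nhdsWithin_of_forall key)

end Entropy

/-! ### Change of measure -/

section Entropy

variable {Ω ι : Type*} [MeasurableSpace Ω] [Fintype ι] {m : Measure Ω} [IsFiniteMeasure m]
  {e : ι → Ω → ℝ}

lemma measurable_log_moment (me : ∀ i, Measurable (e i)) (s : ι → ℝ) :
    Measurable fun g => Real.log (moment m e 1 s g) :=
  Real.measurable_log.comp (measurable_moment me measurable_one s)

lemma exists_log_moment_growth [NeZero m] (me : ∀ i, Measurable (e i)) (he : ∀ i ω, |e i ω| ≤ 1)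
    (s : ι → ℝ) : ∃ K κ : ℝ, 0 ≤ K ∧ 0 ≤ κ ∧ ∀ g,
      |Real.log (moment m e 1 s g)| ≤ K * Real.exp (κ * ∑ i, |g i|) := by
  obtain ⟨K, κ, hK⟩ := exists_moment_growth (m := m) me he (∑ i, |s i|)
  refine ⟨|K|, |κ|, abs_nonneg _, abs_nonneg _, fun g => ?_⟩
  have hpos := moment_one_pos (m := m) me he s g
  have h1 := hK s (fun i => Finset.single_le_sum (f := fun i => |s i|) (fun _ _ => abs_nonneg _)
    (Finset.mem_univ i)) g
  have h2 : moment m e 1 s g + (moment m e 1 s g)⁻¹ + 1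
      ≤ (moment m e 1 s g + (moment m e 1 s g)⁻¹ + 1) ^ 3 :=
    le_self_pow₀ (by linarith [inv_pos.2 hpos]) (by norm_num)
  calc _ ≤ K * Real.exp (κ * ∑ i, |g i|) := by linarith [abs_log_le hpos]
    _ ≤ |K| * Real.exp (|κ| * ∑ i, |g i|) := by
      gcongr
      · exact le_abs_self K
      · exact le_abs_self κ

lemma integrable_log_moment_add [NeZero m] (me : ∀ i, Measurable (e i)) (he : ∀ i ω, |e i ω| ≤ 1)
    (s v : ι → ℝ) : Integrable (fun g => Real.log (moment m e 1 s (g + v))) (gaussPi ι) := by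
  obtain ⟨K, κ, hK, hκ, h⟩ := exists_log_moment_growth (m := m) me he s
  refine integrable_gaussPi_of_le ((measurable_log_moment me s).comp (measurable_add_const v))
    (K := K * Real.exp (κ * ∑ i, |v i|)) (κ := κ) fun g => (h _).trans ?_
  rw [mul_assoc, ← Real.exp_add, ← mul_add, ← Finset.sum_add_distrib]
  gcongr with i
  rw [add_comm |v i|]
  exact abs_add_le _ _

/-- Change of measure: the observation entropy is the expected log-likelihood ratio of an
observation whose signal is drawn from the prior `m`. -/
lemma observationEntropy_eq [NeZero m] (me : ∀ i, Measurable (e i)) (he : ∀ i ω, |e i ω| ≤ 1)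
    (x : ι → ℝ) : observationEntropy m e x = ∫ ω, ∫ g, Real.log
      (moment m e 1 (fun i => √(x i)) (g + fun i => √(x i) * e i ω)) ∂(gaussPi ι) ∂m := by
  set s : ι → ℝ := fun i => √(x i) with hs
  obtain ⟨K, κ, hK, hκ, h⟩ := exists_log_moment_growth (m := m) me he s
  have hR : ∀ i, |s i| ≤ ∑ i, |s i| := fun i =>
    Finset.single_le_sum (f := fun i => |s i|) (fun _ _ => abs_nonneg _) (Finset.mem_univ i)
  have hint : Integrable (Function.uncurry fun (g : ι → ℝ) (ω : Ω) =>
      weight e s g ω * Real.log (moment m e 1 s g)) ((gaussPi ι).prod m) := by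
    refine (((integrable_exp_mul_sum_abs (ι := ι) (∑ i, |s i| + κ)).const_mul K).comp_fst m).mono'
      ?_ (Filter.Eventually.of_forall fun q => ?_)
    · have h1 : Measurable fun q : (ι → ℝ) × Ω => weight e s q.1 q.2 := by
        unfold weight
        fun_prop
      exact (h1.mul ((measurable_log_moment me s).comp measurable_fst)).aestronglyMeasurable
    · have h0 : 0 < weight e s q.1 q.2 := Real.exp_pos _
      rw [Real.norm_eq_abs, Function.uncurry, abs_mul, abs_of_pos h0, add_mul, Real.exp_add]
      calc weight e s q.1 q.2 * |Real.log (moment m e 1 s q.1)|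
          ≤ Real.exp ((∑ i, |s i|) * ∑ i, |q.1 i|) * (K * Real.exp (κ * ∑ i, |q.1 i|)) :=
            mul_le_mul (weight_le he hR q.2) (h q.1) (abs_nonneg _) (Real.exp_pos _).le
        _ = _ := by ring
  calc observationEntropy m e x
      = ∫ g, ∫ ω, weight e s g ω * Real.log (moment m e 1 s g) ∂m ∂(gaussPi ι) := by
        refine integral_congr_ae (Filter.Eventually.of_forall fun g => ?_)
        simp only [integral_mul_const]
        simp [moment, hs]
    _ = ∫ ω, ∫ g, weight e s g ω * Real.log (moment m e 1 s g) ∂(gaussPi ι) ∂m :=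
        integral_integral_swap hint
    _ = _ := by
        refine integral_congr_ae (Filter.Eventually.of_forall fun ω => ?_)
        refine Eq.trans ?_ (integral_add_gaussPi (fun i => s i * e i ω)
          fun g => Real.log (moment m e 1 s g)).symm
        refine integral_congr_ae (Filter.Eventually.of_forall fun g => ?_)
        simp only [weight]
        congr 2
        exact Finset.sum_congr rfl fun i _ => by ring

end Entropy

/-! ### The complex Gaussian disorder -/

section Noise

/-- The complex vector with real and imaginary parts given by the real coordinates. -/
noncomputable def toComplex {C : Type*} (g : ((_ : C) × Fin 2) → ℝ) (a : C) : ℂ :=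
  g ⟨a, 0⟩ + g ⟨a, 1⟩ * Complex.I

lemma toComplex_add {C : Type*} (g h : ((_ : C) × Fin 2) → ℝ) (a : C) :
    toComplex (g + h) a = toComplex g a + toComplex h a := by
  simp only [toComplex, Pi.add_apply, Complex.ofReal_add]
  ring

/-- The law of independent standard complex Gaussians indexed by `C`. -/
noncomputable abbrev complexNoise (C : Type*) [Fintype C] : Measure (C → ℂ) :=
  Measure.pi fun _ => stdGaussian ℂ

lemma stdGaussian_complex_eq_map : stdGaussian ℂ =
    (gaussPi (Fin 2)).map fun h => (h 0 : ℂ) + h 1 * Complex.I := by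
  rw [stdGaussian_eq_map_pi_orthonormalBasis Complex.orthonormalBasisOneI]
  congr 1
  ext h
  simp [Fin.sum_univ_two]

lemma measurePreserving_toComplex (C : Type*) [Fintype C] :
    MeasurePreserving (toComplex (C := C)) (gaussPi ((_ : C) × Fin 2)) (complexNoise C) := by
  have hm : Measurable (toComplex (C := C)) := by
    unfold toComplex
    fun_prop
  refine ⟨hm, ?_⟩
  have h1 := Measure.infinitePi_map_piCurry (ι := C) (κ := fun _ => Fin 2)
    (X := fun _ _ => ℝ) fun _ _ => gaussianReal 0 1
  simp only [Measure.infinitePi_eq_pi] at h1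
  have h2 := Measure.pi_map_pi (μ := fun _ : C => gaussPi (Fin 2))
    (f := fun _ (h : Fin 2 → ℝ) => (h 0 : ℂ) + h 1 * Complex.I) fun _ => by fun_prop
  rw [← stdGaussian_complex_eq_map, ← h1, Measure.map_map (by fun_prop) (by fun_prop)] at h2
  exact h2

lemma complexGaussian_eq_map (D : ℝ) (σ : ℝ≥0) :
    complexGaussian D σ = (stdGaussian ℂ).map fun z => (D : ℂ) + (σ : ℂ) * z := by
  have h1 : (gaussianReal 0 1).map (fun z => D + σ * z) = gaussianReal D (σ ^ 2) := by
    have : (fun z : ℝ => D + σ * z) = (fun z => D + z) ∘ fun z => (σ : ℝ) * z := rfl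
    rw [this, ← Measure.map_map (by fun_prop) (by fun_prop), gaussianReal_map_const_mul,
      gaussianReal_map_const_add]
    congr 1
    · simp
    · ext; simp
  have h2 : (gaussianReal 0 1).map (fun z => (σ : ℝ) * z) = gaussianReal 0 (σ ^ 2) := by
    rw [gaussianReal_map_const_mul]
    congr 1
    · simp
    · ext; simp
  rw [← stdGaussian_map Complex.conjLIE, stdGaussian_complex_eq_map, complexGaussian, ← h1, ← h2,
    Measure.map_prod_map _ _ (by fun_prop) (by fun_prop),
    ← (measurePreserving_finTwoArrow (gaussianReal 0 1)).map_eq,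
    Measure.map_map (by fun_prop) (by fun_prop), Measure.map_map (by fun_prop) (by fun_prop),
    Measure.map_map (by fun_prop) (by fun_prop), Measure.map_map (by fun_prop) (by fun_prop)]
  congr 1
  ext h
  simp [MeasurableEquiv.finTwoArrow]
  ring

lemma disorderLaw_eq_map {Λ : Type*} {B : Finset (Λ × Λ)} {M : Λ × Λ → Finset ℤ}
    (D : Coupling B M → ℝ) (σ : Coupling B M → ℝ≥0) : disorderLaw D σ =
      (complexNoise (Coupling B M)).map fun ζ a => (D a : ℂ) + ((σ a : ℝ) : ℂ) * ζ a := by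
  rw [disorderLaw, complexNoise]
  simp_rw [complexGaussian_eq_map]
  exact (Measure.pi_map_pi (μ := fun _ : Coupling B M => stdGaussian ℂ)
    (f := fun a z => (D a : ℂ) + ((σ a : ℝ) : ℂ) * z) fun a => by fun_prop).symm

end Noise

/-! ### Phase factors and gauge invariance -/

section Phase

variable {Λ : Type*} {B : Finset (Λ × Λ)} {M : Λ × Λ → Finset ℤ} {Φ : AddSubgroup Real.Angle}

lemma phase_add (a : Coupling B M) (φ ψ : Λ → Φ) : phase a (φ + ψ) = phase a φ * phase a ψ := by
  simp only [phase, Pi.add_apply, AddSubgroup.coe_add, add_sub_add_comm, smul_add,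
    Real.Angle.toCircle_add, Circle.coe_mul]

lemma norm_phase (a : Coupling B M) (φ : Λ → Φ) : ‖phase a φ‖ = 1 := Circle.norm_coe _

lemma phase_zero (a : Coupling B M) : phase a (0 : Λ → Φ) = 1 := by
  simp [phase]

lemma measurable_phase [MeasurableSpace Φ] [BorelSpace Φ] (a : Coupling B M) :
    Measurable fun φ : Λ → Φ => phase a φ := by
  have hc : ∀ n : ℤ, Measurable fun θ : Φ => ((n • (θ : Real.Angle)).toCircle : ℂ) := by
    intro n
    refine Continuous.measurable ?_
    have h : Continuous fun θ : Φ => n • (θ : Real.Angle) := continuous_subtype_val.zsmul n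
    simp_rw [Real.Angle.coe_toCircle]
    exact (Complex.continuous_ofReal.comp (Real.Angle.continuous_cos.comp h)).add
      ((Complex.continuous_ofReal.comp (Real.Angle.continuous_sin.comp h)).mul continuous_const)
  have : (fun φ : Λ → Φ => phase a φ) = fun φ =>
      (((a.2 : ℤ) • (φ a.1.1.1 : Real.Angle)).toCircle : ℂ) *
        ((-(a.2 : ℤ) • (φ a.1.1.2 : Real.Angle)).toCircle : ℂ) := by
    ext φ
    rw [phase, sub_eq_add_neg, smul_add, Real.Angle.toCircle_add, Circle.coe_mul, smul_neg,
      neg_smul]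
  rw [this]
  exact ((hc _).comp (measurable_pi_apply _)).mul ((hc _).comp (measurable_pi_apply _))

/-- The real coordinates of the phase factors, with the sign for which
`Re (toComplex g a * phase a φ)` is the sum of `g ⟨a, k⟩ * phaseCoord ⟨a, k⟩ φ` over `k`. -/
noncomputable def phaseCoord (i : (_ : Coupling B M) × Fin 2) (φ : Λ → Φ) : ℝ :=
  ![(phase i.1 φ).re, -(phase i.1 φ).im] i.2

lemma abs_phaseCoord_le (i : (_ : Coupling B M) × Fin 2) (φ : Λ → Φ) : |phaseCoord i φ| ≤ 1 := by
  obtain ⟨a, k⟩ := i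
  fin_cases k
  · simpa [phaseCoord] using (Complex.abs_re_le_norm _).trans_eq (norm_phase a φ)
  · simpa [phaseCoord] using (Complex.abs_im_le_norm _).trans_eq (norm_phase a φ)

lemma measurable_phaseCoord [MeasurableSpace Φ] [BorelSpace Φ]
    (i : (_ : Coupling B M) × Fin 2) : Measurable fun φ : Λ → Φ => phaseCoord i φ := by
  obtain ⟨a, k⟩ := i
  fin_cases k
  · exact Complex.measurable_re.comp (measurable_phase a)
  · exact (Complex.measurable_im.comp (measurable_phase a)).neg

lemma toComplex_phaseCoord (φ : Λ → Φ) (r : Coupling B M → ℝ) (a : Coupling B M) :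
    toComplex (fun i => r i.1 * phaseCoord i φ) a = r a * (starRingEnd ℂ) (phase a φ) := by
  apply Complex.ext <;> simp [toComplex, phaseCoord]

lemma partitionFunction_eq [Fintype Λ] [MeasurableSpace Φ] (μ : Measure Φ) (β : Coupling B M → ℝ)
    (ω : Coupling B M → ℂ) :
    partitionFunction μ β ω = partitionFunction μ 1 fun a => (β a : ℂ) * ω a := by
  simp only [partitionFunction, potential, Pi.one_apply, one_mul, mul_assoc, Complex.re_ofReal_mul]

lemma partitionFunction_toComplex [Fintype Λ] [MeasurableSpace Φ] (μ : Measure Φ)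
    {x : Coupling B M → ℝ} (hx : ∀ a, 0 ≤ x a)
    (g : ((_ : Coupling B M) × Fin 2) → ℝ) :
    partitionFunction μ 1 (fun a => (√(x a) : ℂ) * toComplex g a)
      = Real.exp (∑ a, x a / 2) *
        moment (Measure.pi fun _ : Λ => μ) phaseCoord 1 (fun i => √(x i.1)) g := by
  rw [partitionFunction, moment, ← integral_const_mul]
  congr 1
  ext φ
  have hS := Fintype.sum_sigma fun i : (_ : Coupling B M) × Fin 2 =>
    √(x i.1) * g i * phaseCoord i φ - √(x i.1) ^ 2 * phaseCoord i φ ^ 2 / 2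
  rw [Pi.one_apply, one_mul, weight, ← Real.exp_add, potential, neg_neg, hS,
    ← Finset.sum_add_distrib]
  congr 1
  refine Finset.sum_congr rfl fun a _ => ?_
  have h : (phase a φ).re ^ 2 + (phase a φ).im ^ 2 = 1 := by
    have := Complex.sq_norm_sub_sq_re (phase a φ)
    rw [norm_phase] at this
    linarith
  rw [Fin.sum_univ_two]
  simp only [phaseCoord, toComplex, Real.sq_sqrt (hx a), Matrix.cons_val_zero, Matrix.cons_val_one,
    Pi.one_apply, one_mul, Complex.mul_re, Complex.mul_im, Complex.add_re, Complex.add_im,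
    Complex.ofReal_re, Complex.ofReal_im, Complex.I_re, Complex.I_im]
  linear_combination (x a / 2) * h

end Phase

/-! ### The pressure on the Nishimori line -/

section Partition

variable {Λ : Type*} [Fintype Λ] {B : Finset (Λ × Λ)} {M : Λ × Λ → Finset ℤ}
  {Φ : AddSubgroup Real.Angle} [CompactSpace Φ] [MeasurableSpace Φ] [BorelSpace Φ]
  (μ : Measure Φ) [μ.IsAddHaarMeasure]

/-- Gauge invariance: a shift of the spins absorbs the phase factors of a spin configuration. -/
lemma partitionFunction_gauge (y : Coupling B M → ℂ) (ψ : Λ → Φ) :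
    partitionFunction μ 1 (fun a => (starRingEnd ℂ) (phase a ψ) * y a)
      = partitionFunction μ 1 y := by
  unfold partitionFunction
  rw [← integral_add_right_eq_self _ ψ]
  congr 1
  ext φ
  simp only [potential, phase_add]
  congr 3
  refine Finset.sum_congr rfl fun a _ => ?_
  have h : (starRingEnd ℂ) (phase a ψ) * phase a ψ = 1 := by
    rw [← Complex.normSq_eq_conj_mul_self, Complex.normSq_eq_norm_sq, norm_phase]
    simp
  have : (starRingEnd ℂ) (phase a ψ) * y a * (phase a φ * phase a ψ)
      = ((starRingEnd ℂ) (phase a ψ) * phase a ψ) * (y a * phase a φ) := by ring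
  rw [this, h, one_mul]

lemma measurable_partitionFunction (β : Coupling B M → ℝ) :
    Measurable (partitionFunction μ β) := by
  have : StronglyMeasurable (Function.uncurry fun (ω : Coupling B M → ℂ) (φ : Λ → Φ) =>
      Real.exp (-potential β ω φ)) := by
    refine Measurable.stronglyMeasurable ?_
    unfold potential Function.uncurry
    have h : ∀ a : Coupling B M, Measurable fun q : (Coupling B M → ℂ) × (Λ → Φ) =>
        phase a q.2 := fun a => (measurable_phase a).comp measurable_snd
    fun_prop
  exact this.integral_prod_right.measurable

instance neZero_pi_haar : NeZero (Measure.pi fun _ : Λ => μ) := by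
  refine ⟨fun h => ?_⟩
  have h1 := Measure.pi_univ fun _ : Λ => μ
  rw [h, Measure.coe_zero, Pi.zero_apply] at h1
  obtain ⟨i, _, hi⟩ := Finset.prod_eq_zero_iff.1 h1.symm
  exact (NeZero.ne μ) (Measure.measure_univ_eq_zero.1 hi)

/-- The quenched pressure on the Nishimori line as a function of the parameters `x`: up to affine
terms, the observation entropy of the phase factors under the uniform prior. -/
noncomputable def nishimoriPressure (x : Coupling B M → ℝ) : ℝ :=
  ∑ a, x a / 2 + ((Measure.pi fun _ : Λ => μ).real Set.univ)⁻¹ *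
    observationEntropy (Measure.pi fun _ : Λ => μ) phaseCoord
      fun i : (_ : Coupling B M) × Fin 2 => x i.1

lemma convexOn_nishimoriPressure :
    ConvexOn ℝ {x : Coupling B M → ℝ | ∀ a, 0 ≤ x a} (nishimoriPressure μ) := by
  have h := convexOn_observationEntropy (m := Measure.pi fun _ : Λ => μ)
    (e := phaseCoord (B := B) (M := M)) measurable_phaseCoord abs_phaseCoord_le
  have h1 : ConvexOn ℝ {x : Coupling B M → ℝ | ∀ a, 0 ≤ x a} fun x : Coupling B M → ℝ =>
      observationEntropy (Measure.pi fun _ : Λ => μ) phaseCoord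
        fun i : (_ : Coupling B M) × Fin 2 => x i.1 :=
    (h.comp_linearMap (LinearMap.funLeft ℝ ℝ fun i : (_ : Coupling B M) × Fin 2 => i.1)).subset
      (fun x hx i => hx i.1) (convex_Ici (0 : Coupling B M → ℝ))
  have h2 : ConvexOn ℝ {x : Coupling B M → ℝ | ∀ a, 0 ≤ x a}
      fun x : Coupling B M → ℝ => ∑ a, x a / 2 := by
    refine ⟨convex_Ici (0 : Coupling B M → ℝ), fun u _ v _ a b _ _ _ => le_of_eq ?_⟩
    simp only [Pi.add_apply, Pi.smul_apply, smul_eq_mul, Finset.mul_sum]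
    rw [← Finset.sum_add_distrib]
    exact Finset.sum_congr rfl fun _ _ => by ring
  exact h2.add (h1.smul (inv_nonneg.2 measureReal_nonneg))

/-- The pressure of the rescaled disorder `β ω` whose signal is the configuration `ψ`. -/
lemma integral_log_partitionFunction_signal {x : Coupling B M → ℝ} (hx : ∀ a, 0 ≤ x a)
    (ψ : Λ → Φ) :
    Integrable (fun ζ => Real.log (partitionFunction μ 1
        fun a => (√(x a) : ℂ) * ζ a + x a * (starRingEnd ℂ) (phase a ψ)))
      (complexNoise (Coupling B M)) ∧
    ∫ ζ, Real.log (partitionFunction μ 1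
        fun a => (√(x a) : ℂ) * ζ a + x a * (starRingEnd ℂ) (phase a ψ))
      ∂(complexNoise (Coupling B M))
    = ∑ a, x a / 2 + ∫ g, Real.log (moment (Measure.pi fun _ : Λ => μ) phaseCoord 1
        (fun i => √(x i.1)) (g + fun i : (_ : Coupling B M) × Fin 2 => √(x i.1) * phaseCoord i ψ))
        ∂(gaussPi _) := by
  have mp := measurePreserving_toComplex (Coupling B M)
  have hmeas : Measurable fun ζ : Coupling B M → ℂ => Real.log (partitionFunction μ 1
      fun a => (√(x a) : ℂ) * ζ a + x a * (starRingEnd ℂ) (phase a ψ)) :=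
    Real.measurable_log.comp ((measurable_partitionFunction μ 1).comp (by fun_prop))
  have hint := integrable_log_moment_add (m := Measure.pi fun _ : Λ => μ)
    (e := phaseCoord (B := B) (M := M)) measurable_phaseCoord abs_phaseCoord_le
    (fun i => √(x i.1)) fun i => √(x i.1) * phaseCoord i ψ
  have heq : ∀ g : ((_ : Coupling B M) × Fin 2) → ℝ, Real.log (partitionFunction μ 1
      fun a => (√(x a) : ℂ) * toComplex g a + x a * (starRingEnd ℂ) (phase a ψ))
      = ∑ a, x a / 2 + Real.log (moment (Measure.pi fun _ : Λ => μ) phaseCoord 1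
        (fun i => √(x i.1)) (g + fun i => √(x i.1) * phaseCoord i ψ)) := by
    intro g
    have h1 : (fun a => (√(x a) : ℂ) * toComplex g a + x a * (starRingEnd ℂ) (phase a ψ))
        = fun a => (√(x a) : ℂ) * toComplex (g + fun i => √(x i.1) * phaseCoord i ψ) a := by
      ext a
      rw [toComplex_add, toComplex_phaseCoord ψ (fun a => √(x a)), mul_add, ← mul_assoc _ _
        ((starRingEnd ℂ) (phase a ψ)), ← Complex.ofReal_mul, Real.mul_self_sqrt (hx a)]
    rw [h1, partitionFunction_toComplex μ hx, Real.log_mul (Real.exp_pos _).ne'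
      (moment_one_pos measurable_phaseCoord abs_phaseCoord_le _ _).ne', Real.log_exp]
  constructor
  · rw [← mp.map_eq, integrable_map_measure hmeas.aestronglyMeasurable mp.measurable.aemeasurable]
    refine ((integrable_const (∑ a, x a / 2)).add hint).congr
      (Filter.Eventually.of_forall fun g => ?_)
    exact (heq g).symm
  · rw [← mp.map_eq, integral_map mp.measurable.aemeasurable hmeas.aestronglyMeasurable]
    simp_rw [heq]
    rw [integral_add (integrable_const _) hint]
    simp

/-- By gauge invariance, the pressure does not depend on which configuration is the signal. -/
lemma integral_log_partitionFunction_gauge (x : Coupling B M → ℝ) (ψ : Λ → Φ) :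
    ∫ ζ, Real.log (partitionFunction μ 1
        fun a => (√(x a) : ℂ) * ζ a + x a * (starRingEnd ℂ) (phase a ψ))
      ∂(complexNoise (Coupling B M))
    = ∫ ζ, Real.log (partitionFunction μ 1 fun a => (√(x a) : ℂ) * ζ a + x a)
      ∂(complexNoise (Coupling B M)) := by
  let c : Coupling B M → Circle := fun a =>
    ((a.2 : ℤ) • ((ψ a.1.1.1 : Real.Angle) - (ψ a.1.1.2 : Real.Angle))).toCircle
  have hc : ∀ a, ((c a)⁻¹ : Circle) = (starRingEnd ℂ) (phase a ψ) := fun a =>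
    Circle.coe_inv_eq_conj (c a)
  have mp : MeasurePreserving
      (fun (ζ : Coupling B M → ℂ) a => (starRingEnd ℂ) (phase a ψ) * ζ a)
      (complexNoise (Coupling B M)) (complexNoise (Coupling B M)) := by
    refine measurePreserving_pi _ _ fun a => ⟨by fun_prop, ?_⟩
    have := stdGaussian_map (rotation (c a)⁻¹)
    rw [← hc]
    exact this
  have hmeas : Measurable fun ζ : Coupling B M → ℂ => Real.log (partitionFunction μ 1
      fun a => (√(x a) : ℂ) * ζ a + x a * (starRingEnd ℂ) (phase a ψ)) :=
    Real.measurable_log.comp ((measurable_partitionFunction μ 1).comp (by fun_prop))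
  conv_lhs => rw [← mp.map_eq]
  rw [integral_map mp.measurable.aemeasurable (by rw [mp.map_eq]; exact hmeas.aestronglyMeasurable)]
  congr 1
  ext ζ
  rw [← partitionFunction_gauge μ (fun a => (√(x a) : ℂ) * ζ a + x a) ψ]
  congr 3
  ext a
  ring

lemma integral_log_partitionFunction_eq {x : Coupling B M → ℝ} (hx : ∀ a, 0 ≤ x a) :
    ∫ ζ, Real.log (partitionFunction μ 1 fun a => (√(x a) : ℂ) * ζ a + x a)
      ∂(complexNoise (Coupling B M)) = nishimoriPressure μ x := by
  set p := ∫ ζ, Real.log (partitionFunction μ 1 fun a => (√(x a) : ℂ) * ζ a + x a)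
    ∂(complexNoise (Coupling B M)) with hp
  have h := observationEntropy_eq (m := Measure.pi fun _ : Λ => μ)
    (e := phaseCoord (B := B) (M := M)) measurable_phaseCoord abs_phaseCoord_le fun i => x i.1
  have h1 : ∀ ψ : Λ → Φ, ∫ g, Real.log (moment (Measure.pi fun _ : Λ => μ) phaseCoord 1
      (fun i => √(x i.1)) (g + fun i : (_ : Coupling B M) × Fin 2 => √(x i.1) * phaseCoord i ψ))
      ∂(gaussPi _) = p - ∑ a, x a / 2 := fun ψ => by
    rw [hp, ← integral_log_partitionFunction_gauge μ x ψ,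
      (integral_log_partitionFunction_signal μ hx ψ).2]
    ring
  simp_rw [h1] at h
  rw [integral_const, smul_eq_mul] at h
  have h0 : (Measure.pi fun _ : Λ => μ).real Set.univ ≠ 0 := measureReal_univ_pos.ne'
  rw [nishimoriPressure, h, inv_mul_cancel_left₀ h0]
  ring

/-- On the Nishimori line, `β ω` has mean `x` and noise of variance `x` in each component. -/
lemma integrable_log_partitionFunction_and_eq {β D : Coupling B M → ℝ} {σ : Coupling B M → ℝ≥0}
    (hβ : ∀ a, 0 ≤ β a) (hN : OnNishimoriLine β D σ) :
    Integrable (fun ω => Real.log (partitionFunction μ β ω)) (disorderLaw D σ) ∧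
      quenchedPressure μ β D σ = nishimoriPressure μ fun a => β a * D a := by
  have hx : ∀ a, 0 ≤ β a * D a := fun a => by
    rw [hN a]
    exact mul_nonneg (hβ a) (mul_nonneg (hβ a) (sq_nonneg _))
  have hsqrt : ∀ a, √(β a * D a) = β a * σ a := fun a => by
    rw [hN a, show β a * (β a * (σ a : ℝ) ^ 2) = (β a * σ a) ^ 2 by ring,
      Real.sqrt_sq (mul_nonneg (hβ a) (σ a).coe_nonneg)]
  have hmeas : Measurable fun ω : Coupling B M → ℂ => Real.log (partitionFunction μ β ω) :=
    Real.measurable_log.comp (measurable_partitionFunction μ β)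
  have hmap : Measurable fun (ζ : Coupling B M → ℂ) a => (D a : ℂ) + ((σ a : ℝ) : ℂ) * ζ a := by
    fun_prop
  have heq : ∀ ζ : Coupling B M → ℂ,
      partitionFunction μ β (fun a => (D a : ℂ) + ((σ a : ℝ) : ℂ) * ζ a) =
        partitionFunction μ 1 fun a => (√(β a * D a) : ℂ) * ζ a + (β a * D a : ℝ) := fun ζ => by
    rw [partitionFunction_eq]
    congr 1
    ext a
    rw [hsqrt]
    push_cast
    ring
  have hint := (integral_log_partitionFunction_signal μ hx 0).1
  simp only [phase_zero, map_one, mul_one] at hint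
  constructor
  · rw [disorderLaw_eq_map, integrable_map_measure hmeas.aestronglyMeasurable hmap.aemeasurable]
    refine hint.congr (Filter.Eventually.of_forall fun ζ => ?_)
    simp only [Function.comp_apply, heq]
  · rw [quenchedPressure, disorderLaw_eq_map,
      integral_map hmap.aemeasurable hmeas.aestronglyMeasurable]
    simp_rw [heq]
    exact integral_log_partitionFunction_eq μ hx

end Partition

end GaugeGlass

/-- On the Nishimori line, `log Z` is integrable, its expectation depends on the parameters only
through `x_{ij,m} = β_{ij,m} D_{ij,m}`, and as a function of `x` it is convex on the orthant of
all `x` with nonnegative coordinates (every such `x` occurs). -/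
theorem theorem3 {Λ : Type*} [Fintype Λ] (B : Finset (Λ × Λ)) (M : Λ × Λ → Finset ℤ)
    (Φ : AddSubgroup Real.Angle) [CompactSpace Φ] [MeasurableSpace Φ] [BorelSpace Φ]
    (μ : Measure Φ) [μ.IsAddHaarMeasure] :
    ∃ p : (GaugeGlass.Coupling B M → ℝ) → ℝ,
      (∀ (β D : GaugeGlass.Coupling B M → ℝ) (σ : GaugeGlass.Coupling B M → ℝ≥0),
        (∀ a, 0 ≤ β a) → GaugeGlass.OnNishimoriLine β D σ →
          Integrable (fun ω => Real.log (GaugeGlass.partitionFunction μ β ω))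
              (GaugeGlass.disorderLaw D σ) ∧
            GaugeGlass.quenchedPressure μ β D σ = p (fun a => β a * D a)) ∧
      ConvexOn ℝ {x : GaugeGlass.Coupling B M → ℝ | ∀ a, 0 ≤ x a} p :=
  ⟨GaugeGlass.nishimoriPressure μ,
    fun _ _ _ hβ hN => GaugeGlass.integrable_log_partitionFunction_and_eq μ hβ hN,
    GaugeGlass.convexOn_nishimoriPressure μ⟩
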